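/- Let $d_1,d_2$ be natural numbers and consider a two-player quantum game: player $i\in\{1,2\}$ has state space $\mathbb C^{d_i}$; there is a finite set $\Omega$ of measurement outcomes with positive semidefinite operators $P_\omega$ on $\mathbb C^{d_1}\otimes\mathbb C^{d_2}$, $\sum_{\omega\in\Omega} P_\omega = I$, and payoff observables $U_i:\Omega\to\mathbb R$. Write $\mathcal Y_i$ for the real vector space of $d_i\times d_i$ Hermitian matrices, $\mathcal Y=\mathcal Y_1\times\mathcal Y_2$, let $\mathcal X_i=\{X_i\in\mathcal Y_i: X_i\succeq 0,\ \operatorname{tr}X_i=1\}$ be the set of density matrices, and $\mathcal X=\mathcal X_1\times\mathcal X_2$. The expected payoff of player $i$ is $u_i(X)=\sum_{\omega}U_i(\omega)\operatorname{tr}[P_\omega(X_1\otimes X_2)]$, and $V_i(X)\in\mathcal Y_i$ denotes the individual payoff gradient, i.e. the Hermitian matrix, depending only on the other player's state $X_{-i}$, with $u_i(X_i';X_{-i})=\operatorname{tr}[X_i'V_i(X)]$ for all $X_i'\in\mathcal X_i$. Assume that the game is zero-sum, $u_1=-u_2$ on $\mathcal X$, and that it has a Nash equilibrium $X^*=(X_1^*,X_2^*)\in\mathcal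 X$ (that is, $u_1(X_1,X_2^*)\le u_1(X^*)$ for all $X_1\in\mathcal X_1$ and $u_2(X_1^*,X_2)\le u_2(X^*)$ for all $X_2\in\mathcal X_2$) such that $X_1^*$ and $X_2^*$ have full rank. For $i=1,2$ let $\theta_i:[0,1]\to\mathbb R$ be continuous, with $\theta_i(0)=0$, twice differentiable on $(0,1]$ with $\inf_{x\in(0,1]}\theta_i''(x)>0$; put $h_i(X_i)=\operatorname{tr}[\theta_i(X_i)]$ for $X_i\in\mathcal X_i$ and $Q_i(Y_i)=\operatorname{argmax}_{X_i\in\mathcal X_i}\{\operatorname{tr}[Y_iX_i]-h_i(X_i)\}$ for $Y_i\in\mathcal Y_i$, and write $Q=(Q_1,Q_2)$. Consider the follow-the-quantum-leader (FTQL) dynamics $$\dot Y_i(t)=V_i(X(t)),\qquad X_i(t)=Q_i(Y_i(t)),\qquad i=1,2,\quad t\ge 0.$$ **Theorem.** The dynamics admit a solution on $[0,\infty)$ from every initial condition $Y(0)\in\mathcal Y$, and almost every solution orbit $X(t)=Q(Y(t))$ is Poincaré recurrent: there exists an increasing sequence of times $t_n\to\infty$ such that $\lim_{n\to\infty}X(t_n)=X(0)$.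 Here "almost every" holds in both of the following senses: for every solution orbit whose initial score $Y(0)$ lies outside some set of Lebesgue measure zero in $\mathcal Y$; and for every solution orbit whose initial state $X(0)$ lies outside some set of Lebesgue measure zero in the affine space of pairs of Hermitian matrices of trace one (the affine hull of $\mathcal X$). -/

import Mathlib

open Filter Topology MeasureTheory
open scoped Matrix Kronecker ComplexOrder

namespace QuantumGame

noncomputable section

/-! ## Hermitian matrices and mixed states -/

/-- The real vector space of `d × d` complex Hermitian matrices. -/
def Herm (d : ℕ) : Type :=
  ↥(selfAdjoint.submodule ℝ (Matrix (Fin d) (Fin d) ℂ))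

namespace Herm

variable {d : ℕ}

instance instAddCommGroup : AddCommGroup (Herm d) :=
  inferInstanceAs (AddCommGroup ↥(selfAdjoint.submodule ℝ (Matrix (Fin d) (Fin d) ℂ)))

instance instModule : Module ℝ (Herm d) :=
  inferInstanceAs (Module ℝ ↥(selfAdjoint.submodule ℝ (Matrix (Fin d) (Fin d) ℂ)))

instance instFiniteDimensional : FiniteDimensional ℝ (Herm d) :=
  haveI : FiniteDimensional ℝ (Matrix (Fin d) (Fin d) ℂ) :=
    FiniteDimensional.trans ℝ ℂ (Matrix (Fin d) (Fin d) ℂ)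
  inferInstanceAs (FiniteDimensional ℝ ↥(selfAdjoint.submodule ℝ (Matrix (Fin d) (Fin d) ℂ)))

/-- The underlying matrix of an element of `Herm d`. -/
def mat (X : Herm d) : Matrix (Fin d) (Fin d) ℂ := X.1

theorem isHermitian (X : Herm d) : X.mat.IsHermitian := X.2

@[simp] theorem mat_zero : (0 : Herm d).mat = 0 := rfl
@[simp] theorem mat_add (X Y : Herm d) : (X + Y).mat = X.mat + Y.mat := rfl
@[simp] theorem mat_smul (r : ℝ) (X : Herm d) : (r • X).mat = r • X.mat := rfl

/-- The trace pairing `tr(A B)` of Hermitian matrices (it is a real number). -/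
def tracePairing (A B : Herm d) : ℝ := (A.mat * B.mat).trace.re

theorem tracePairing_self (A : Herm d) :
    tracePairing A A = ∑ i, ∑ j, Complex.normSq (A.mat i j) := by
  unfold tracePairing
  simp only [Matrix.trace, Matrix.diag, Matrix.mul_apply, Complex.re_sum]
  refine Finset.sum_congr rfl fun i _ => Finset.sum_congr rfl fun j _ => ?_
  have h := A.isHermitian.apply j i
  rw [← h, Complex.star_def, Complex.mul_conj, Complex.ofReal_re]

theorem tracePairing_self_nonneg (A : Herm d) : 0 ≤ tracePairing A A := by
  rw [tracePairing_self]
  exact Finset.sum_nonneg fun i _ => Finset.sum_nonneg fun j _ => Complex.normSq_nonneg _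

theorem eq_zero_of_tracePairing_self (A : Herm d) (hA : tracePairing A A = 0) : A = 0 := by
  rw [tracePairing_self] at hA
  have hnn : ∀ i j, 0 ≤ Complex.normSq (A.mat i j) := fun i j => Complex.normSq_nonneg _
  refine Subtype.ext (Matrix.ext fun i j => ?_)
  have h1 := (Finset.sum_eq_zero_iff_of_nonneg
    (fun i _ => Finset.sum_nonneg fun j _ => hnn i j)).mp hA i (Finset.mem_univ i)
  have h2 := (Finset.sum_eq_zero_iff_of_nonneg (fun j _ => hnn i j)).mp h1 j (Finset.mem_univ j)
  exact Complex.normSq_eq_zero.mp h2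

/-- The trace pairing is an inner product on `Herm d`; the associated norm is the Frobenius
norm. -/
@[reducible] def innerCore : InnerProductSpace.Core ℝ (Herm d) where
  inner := tracePairing
  conj_inner_symm A B := by
    simp only [tracePairing, conj_trivial]
    rw [Matrix.trace_mul_comm]
  re_inner_nonneg A := tracePairing_self_nonneg A
  add_left A B C := by simp [tracePairing, add_mul]
  smul_left A B r := by simp [tracePairing]
  definite A hA := eq_zero_of_tracePairing_self A hA

instance instNormedAddCommGroup : NormedAddCommGroup (Herm d) := innerCore.toNormedAddCommGroup

instance instInnerProductSpace : InnerProductSpace ℝ (Herm d) :=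
  InnerProductSpace.ofCore innerCore.toCore

theorem inner_eq (A B : Herm d) : inner ℝ A B = tracePairing A B := rfl

instance instMeasurableSpace : MeasurableSpace (Herm d) := borel _

instance instBorelSpace : BorelSpace (Herm d) := ⟨rfl⟩

instance instProperSpace : ProperSpace (Herm d) := FiniteDimensional.proper_real (Herm d)

end Herm

/-- The spectraplex of density matrices: positive semidefinite matrices of trace one. -/
def densityMatrices (d : ℕ) : Set (Herm d) :=
  {X | X.mat.PosSemidef ∧
    X.mat.trace = 1}

/-! ## Two-player quantum games -/

/-- A two-player quantum game with state spaces `ℂ^d₁` and `ℂ^d₂` and finite set `Ω` of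
measurement outcomes: a positive operator-valued measurement on the tensor product
`ℂ^d₁ ⊗ ℂ^d₂` (with its product basis) and one payoff observable for each player. -/
structure Game (d₁ d₂ : ℕ) (Ω : Type*) [Fintype Ω] where
  povm : Ω → Matrix (Fin d₁ × Fin d₂) (Fin d₁ × Fin d₂) ℂ
  povm_posSemidef : ∀ ω, (povm ω).PosSemidef
  povm_sum : ∑ ω, povm ω = 1
  obs₁ : Ω → ℝ
  obs₂ : Ω → ℝ

variable {d₁ d₂ : ℕ} {Ω : Type*} [Fintype Ω]

/-- Born's rule: the probability `tr(P_ω (X₁ ⊗ X₂))` of observing `ω` when the players prepare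
the mixed states `X₁` and `X₂` independently. -/
def Game.prob (G : Game d₁ d₂ Ω) (ω : Ω)
    (X₁ : Matrix (Fin d₁) (Fin d₁) ℂ) (X₂ : Matrix (Fin d₂) (Fin d₂) ℂ) : ℝ :=
  (G.povm ω * (X₁ ⊗ₖ X₂)).trace.re

/-- On pure states `|ψ₁⟩⟨ψ₁|` and `|ψ₂⟩⟨ψ₂|`, the outcome probability is
`⟨ψ₁ ⊗ ψ₂| P_ω |ψ₁ ⊗ ψ₂⟩`. -/
theorem Game.prob_pure (G : Game d₁ d₂ Ω) (ω : Ω) (ψ₁ : Fin d₁ → ℂ) (ψ₂ : Fin d₂ → ℂ) :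
    G.prob ω (Matrix.vecMulVec ψ₁ (star ψ₁)) (Matrix.vecMulVec ψ₂ (star ψ₂)) =
      (star (fun p : Fin d₁ × Fin d₂ => ψ₁ p.1 * ψ₂ p.2) ⬝ᵥ
        (G.povm ω *ᵥ fun p : Fin d₁ × Fin d₂ => ψ₁ p.1 * ψ₂ p.2)).re := by
  unfold Game.prob
  congr 1
  simp only [Matrix.trace, Matrix.diag, Matrix.mul_apply, dotProduct, Matrix.mulVec,
    Matrix.kroneckerMap_apply, Matrix.vecMulVec_apply, Pi.star_apply, Finset.mul_sum, star_mul']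
  refine Finset.sum_congr rfl fun p _ => Finset.sum_congr rfl fun q _ => ?_
  ring

/-- Expected payoff of the first player. -/
def Game.payoff₁ (G : Game d₁ d₂ Ω) (X₁ : Herm d₁) (X₂ : Herm d₂) : ℝ :=
  ∑ ω, G.prob ω X₁.mat X₂.mat * G.obs₁ ω

/-- Expected payoff of the second player. -/
def Game.payoff₂ (G : Game d₁ d₂ Ω) (X₁ : Herm d₁) (X₂ : Herm d₂) : ℝ :=
  ∑ ω, G.prob ω X₁.mat X₂.mat * G.obs₂ ω

/-- The game is zero-sum: the payoffs of the two players are opposite at every mixed state. -/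
def Game.IsZeroSum (G : Game d₁ d₂ Ω) : Prop :=
  ∀ X₁ ∈ densityMatrices d₁, ∀ X₂ ∈ densityMatrices d₂,
    G.payoff₁ X₁ X₂ = - G.payoff₂ X₁ X₂

/-- `(E₁, E₂)` is a Nash equilibrium in mixed states. -/
def Game.IsNashEquilibrium (G : Game d₁ d₂ Ω) (E₁ : Herm d₁) (E₂ : Herm d₂) : Prop :=
  E₁ ∈ densityMatrices d₁ ∧ E₂ ∈ densityMatrices d₂ ∧
    (∀ X₁ ∈ densityMatrices d₁, G.payoff₁ X₁ E₂ ≤ G.payoff₁ E₁ E₂) ∧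
    (∀ X₂ ∈ densityMatrices d₂, G.payoff₂ E₁ X₂ ≤ G.payoff₂ E₁ E₂)

/-! ## Payoff gradients -/

/-- The payoff gradient `V₁` of the first player, as a function of the state of the second
player: `∑_ω U₁(ω) tr₂(P_ω (1 ⊗ X₂))`, with `tr₂` the partial trace. -/
def Game.gradient₁ (G : Game d₁ d₂ Ω) (X₂ : Herm d₂) : Herm d₁ :=
  ⟨Matrix.of fun a b => ∑ ω, (G.obs₁ ω : ℂ) *
      ∑ c, ∑ d, G.povm ω (a, c) (b, d) * X₂.mat d c, by
    change Matrix.IsHermitian _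
    refine Matrix.IsHermitian.ext fun a b => ?_
    simp only [Matrix.of_apply, star_sum, star_mul', Complex.star_def, Complex.conj_ofReal]
    refine Finset.sum_congr rfl fun ω _ => ?_
    congr 1
    rw [Finset.sum_comm]
    refine Finset.sum_congr rfl fun c _ => Finset.sum_congr rfl fun d _ => ?_
    have h1 := (G.povm_posSemidef ω).1.apply (a, c) (b, d)
    have h2 := X₂.isHermitian.apply d c
    rw [Complex.star_def] at h1 h2
    rw [h1, h2]⟩

/-- The payoff gradient `V₂` of the second player, as a function of the state of the first
player: `∑_ω U₂(ω) tr₁(P_ω (X₁ ⊗ 1))`, with `tr₁` the partial trace. -/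
def Game.gradient₂ (G : Game d₁ d₂ Ω) (X₁ : Herm d₁) : Herm d₂ :=
  ⟨Matrix.of fun c d => ∑ ω, (G.obs₂ ω : ℂ) *
      ∑ a, ∑ b, G.povm ω (a, c) (b, d) * X₁.mat b a, by
    change Matrix.IsHermitian _
    refine Matrix.IsHermitian.ext fun c d => ?_
    simp only [Matrix.of_apply, star_sum, star_mul', Complex.star_def, Complex.conj_ofReal]
    refine Finset.sum_congr rfl fun ω _ => ?_
    congr 1
    rw [Finset.sum_comm]
    refine Finset.sum_congr rfl fun a _ => Finset.sum_congr rfl fun b _ => ?_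
    have h1 := (G.povm_posSemidef ω).1.apply (a, c) (b, d)
    have h2 := X₁.isHermitian.apply b a
    rw [Complex.star_def] at h1 h2
    rw [h1, h2]⟩

/-- `V₁(X₂)` represents the payoff of the first player, which is linear in `X₁`, with respect to
the trace pairing; hence it is the individual payoff gradient. -/
theorem Game.payoff₁_eq (G : Game d₁ d₂ Ω) (X₁ : Herm d₁) (X₂ : Herm d₂) :
    G.payoff₁ X₁ X₂ = Herm.tracePairing X₁ (G.gradient₁ X₂) := by
  have key : (∑ ω, (G.povm ω * (X₁.mat ⊗ₖ
        X₂.mat)).trace * (G.obs₁ ω : ℂ)) =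
      (X₁.mat *
        (G.gradient₁ X₂).mat).trace := by
    simp only [Game.gradient₁, Herm.mat, Matrix.trace, Matrix.diag, Matrix.mul_apply, Matrix.of_apply,
      Matrix.kroneckerMap_apply, Finset.mul_sum, Finset.sum_mul, Fintype.sum_prod_type]
    rw [Finset.sum_comm]
    conv_rhs => rw [Finset.sum_comm]
    refine Finset.sum_congr rfl fun a _ => ?_
    rw [Finset.sum_comm (s := (Finset.univ : Finset (Fin d₁)))]
    refine Finset.sum_congr rfl fun ω _ => ?_
    rw [Finset.sum_comm]
    refine Finset.sum_congr rfl fun b _ => Finset.sum_congr rfl fun c _ =>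
      Finset.sum_congr rfl fun d _ => ?_
    ring
  have h := congrArg Complex.re key
  simpa [Game.payoff₁, Game.prob, Herm.tracePairing, Complex.re_sum, Complex.re_mul_ofReal] using h

/-- `V₂(X₁)` represents the payoff of the second player, which is linear in `X₂`, with respect to
the trace pairing; hence it is the individual payoff gradient. -/
theorem Game.payoff₂_eq (G : Game d₁ d₂ Ω) (X₁ : Herm d₁) (X₂ : Herm d₂) :
    G.payoff₂ X₁ X₂ = Herm.tracePairing X₂ (G.gradient₂ X₁) := by
  have key : (∑ ω, (G.povm ω * (X₁.mat ⊗ₖ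
        X₂.mat)).trace * (G.obs₂ ω : ℂ)) =
      (X₂.mat *
        (G.gradient₂ X₁).mat).trace := by
    simp only [Game.gradient₂, Herm.mat, Matrix.trace, Matrix.diag, Matrix.mul_apply, Matrix.of_apply,
      Matrix.kroneckerMap_apply, Finset.mul_sum, Finset.sum_mul, Fintype.sum_prod_type]
    conv_rhs => rw [Finset.sum_comm]
    conv_rhs => enter [2, c]; rw [Finset.sum_comm]
    conv_rhs => rw [Finset.sum_comm]
    refine Finset.sum_congr rfl fun ω _ => ?_
    rw [Finset.sum_comm]
    refine Finset.sum_congr rfl fun c _ => ?_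
    conv_rhs => rw [Finset.sum_comm]
    refine Finset.sum_congr rfl fun a _ => ?_
    conv_rhs => rw [Finset.sum_comm]
    refine Finset.sum_congr rfl fun b _ => Finset.sum_congr rfl fun d _ => ?_
    ring
  have h := congrArg Complex.re key
  simpa [Game.payoff₂, Game.prob, Herm.tracePairing, Complex.re_sum, Complex.re_mul_ofReal] using h

/-! ## Regularized learning -/

/-- Admissible regularizer kernels: `θ` is continuous on `[0,1]`, twice differentiable on `(0,1]`
(one-sidedly at `1`) with `inf_{(0,1]} θ'' > 0`, and normalized by `θ(0) = 0`. -/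
def IsRegularizerKernel (θ : ℝ → ℝ) : Prop :=
  ContinuousOn θ (Set.Icc 0 1) ∧ θ 0 = 0 ∧
    ∃ θ' θ'' : ℝ → ℝ,
      (∀ x ∈ Set.Ioc (0 : ℝ) 1, HasDerivWithinAt θ (θ' x) (Set.Ioc 0 1) x) ∧
      (∀ x ∈ Set.Ioc (0 : ℝ) 1, HasDerivWithinAt θ' (θ'' x) (Set.Ioc 0 1) x) ∧
      ∃ c > 0, ∀ x ∈ Set.Ioc (0 : ℝ) 1, c ≤ θ'' x

/-- The regularizer `h(X) = tr(θ(X))`, where `θ(X)` is given by the functional calculus of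
Hermitian matrices, i.e. `θ` is applied to the eigenvalues in a unitary eigendecomposition. -/
def regularizer {d : ℕ} (θ : ℝ → ℝ) (X : Herm d) : ℝ :=
  (X.isHermitian.cfc θ).trace.re

/-- `X = Q(Y)`: the density matrix `X` maximizes `tr(Y X') - h(X')` over all density
matrices `X'`. -/
def IsRegularizedBestResponse {d : ℕ} (θ : ℝ → ℝ) (Y X : Herm d) : Prop :=
  X ∈ densityMatrices d ∧
    ∀ X' ∈ densityMatrices d,
      Herm.tracePairing Y X' - regularizer θ X' ≤ Herm.tracePairing Y X - regularizer θ X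

/-- `(Y, X)` is a solution of the dynamics `Y_i' = V_i(X)`, `X_i = Q_i(Y_i)` on `[0, ∞)`; at time
`0` the derivative is one-sided. Values at negative times are irrelevant. -/
def Game.IsFTQLSolution (G : Game d₁ d₂ Ω) (θ₁ θ₂ : ℝ → ℝ)
    (Y X : ℝ → Herm d₁ × Herm d₂) : Prop :=
  ∀ t, 0 ≤ t →
    IsRegularizedBestResponse θ₁ (Y t).1 (X t).1 ∧
    IsRegularizedBestResponse θ₂ (Y t).2 (X t).2 ∧
    HasDerivWithinAt Y (G.gradient₁ (X t).2, G.gradient₂ (X t).1) (Set.Ici 0) t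

/-- The orbit `X(t)`, `t ≥ 0`, returns to its starting point along an increasing sequence of
times tending to infinity. -/
def IsPoincareRecurrent {E : Type*} [TopologicalSpace E] (X : ℝ → E) : Prop :=
  ∃ τ : ℕ → ℝ, (∀ n, 0 ≤ τ n) ∧ StrictMono τ ∧ Tendsto τ atTop atTop ∧
    Tendsto (fun n => X (τ n)) atTop (𝓝 (X 0))

/-! ## Lebesgue measure -/

/-- Lebesgue measure (up to normalization) on pairs of Hermitian matrices. -/
def hermLebesgue (d₁ d₂ : ℕ) : Measure (Herm d₁ × Herm d₂) :=
  (Measure.addHaar : Measure (Herm d₁)).prod (Measure.addHaar : Measure (Herm d₂))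

/-- The real vector space of traceless Hermitian matrices. -/
def tracelessHerm (d : ℕ) : Submodule ℝ (Herm d) where
  carrier := {Z | Z.mat.trace = 0}
  add_mem' := by
    intro A B hA hB
    change Matrix.trace _ = 0 at hA hB ⊢
    simp [hA, hB]
  zero_mem' := by simp
  smul_mem' := by
    intro c A hA
    change Matrix.trace _ = 0 at hA ⊢
    simp [hA]

instance tracelessHerm.instProperSpace (d : ℕ) : ProperSpace (tracelessHerm d) :=
  FiniteDimensional.proper_real (tracelessHerm d)

/-- The maximally mixed state `(1/d) 1`. -/
def maximallyMixed (d : ℕ) : Herm d :=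
  ⟨((d : ℝ)⁻¹) • (1 : Matrix (Fin d) (Fin d) ℂ), by
    change IsSelfAdjoint _
    exact (IsSelfAdjoint.all _).smul (IsSelfAdjoint.one _)⟩

/-- For `d ≥ 1`, the Lebesgue measure (up to normalization) of the affine space of Hermitian
`d × d` matrices of trace one, which is the affine hull of the set of density matrices. -/
def traceOneLebesgue (d : ℕ) : Measure (Herm d) :=
  Measure.map (fun Z : tracelessHerm d => maximallyMixed d + (Z : Herm d)) Measure.addHaar

/-- Lebesgue measure (up to normalization) on pairs of Hermitian matrices of trace one. -/
def stateLebesgue (d₁ d₂ : ℕ) : Measure (Herm d₁ × Herm d₂) :=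
  (traceOneLebesgue d₁).prod (traceOneLebesgue d₂)

end

end QuantumGame

/-!
The dynamics is an autonomous differential equation for the score `Y`, whose field
`(V₁(Q₂ Y₂), V₂(Q₁ Y₁))` is bounded and globally Lipschitz: the state space is compact, the payoff
gradients are linear, and the mirror map `Q` of a strongly convex regularizer is Lipschitz
(`lipschitzWith_mirrorMap`). Strong convexity of `X ↦ tr θ(X)` (`strongConvexOn_regularizer`) and
its lower semicontinuity both come from Peierls' inequality `sum_le_regularizer`, which presents the
regularizer as a maximum of `∑ᵢ θ(⟨bᵢ, X bᵢ⟩)` over orthonormal bases `b`. Hence solutions exist for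
all times.

For recurrence, the scores are projected orthogonally to the traceless matrices; this loses nothing,
since multiples of the identity do not affect `Q`, and it makes three facts available.

* The projected field is separable: the velocity of each player depends on the score of the other
  player only. Such a flow preserves volume. As the field is merely Lipschitz, no divergence is
  taken; instead, symplectic Euler steps are compositions of two shears, hence measure-preserving,
  and they converge uniformly to the time-one map (`measurePreserving_timeOneMap`).
* The total Fenchel coupling `∑ᵢ hᵢ*(Zᵢ) - ⟪Zᵢ, Eᵢ⟫` with the equilibrium `(E₁, E₂)` is conserved
  (`fenchelCoupling_add_eq`): the gradient of `hᵢ*` is `Qᵢ`, the payoffs cancel in a zero-sum game,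
  and at an interior equilibrium the payoff gradients are orthogonal to the traceless matrices.
* The coupling grows linearly on traceless matrices, because the equilibrium has full rank
  (`mul_norm_le_fenchelCoupling`). Its sublevel sets are therefore bounded.

The time-one map thus preserves finite measures on the sublevel sets, and Poincaré's theorem applies
(`ae_exists_recurrent`). Null sets of projected scores pull back to null sets of scores along the
surjective projection. The initial state is a Lipschitz function of the projected initial score
between spaces of equal dimension, so null sets of projected scores also yield null sets of initial
states, with no need to invert `Q`.
-/

namespace QuantumGame

open Set
open scoped NNReal

/-! ### Trajectories of bounded Lipschitz vector fields -/

/-- `z` solves `z' = v(z)` on `[0, ∞)`, the derivative at time `0` being one-sided. -/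
def IsForwardTrajectory {E : Type*} [NormedAddCommGroup E] [NormedSpace ℝ E]
    (v : E → E) (z : ℝ → E) : Prop :=
  ∀ t, 0 ≤ t → HasDerivWithinAt z (v (z t)) (Ici 0) t

section Trajectory

variable {E : Type*} [NormedAddCommGroup E] [NormedSpace ℝ E] {v : E → E} {K L : ℝ≥0}

theorem eqOn_Icc_of_hasDerivWithinAt (hv : LipschitzWith K v) {y z : ℝ → E} {T : ℝ}
    (hy : ∀ t ∈ Icc 0 T, HasDerivWithinAt y (v (y t)) (Icc 0 T) t)
    (hz : ∀ t ∈ Icc 0 T, HasDerivWithinAt z (v (z t)) (Icc 0 T) t) (h0 : y 0 = z 0) :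
    EqOn y z (Icc 0 T) :=
  ODE_solution_unique (v := fun _ => v) (fun _ => hv)
    (fun t ht => (hy t ht).continuousWithinAt)
    (fun t ht => (hy t ⟨ht.1, ht.2.le⟩).mono_of_mem_nhdsWithin (Icc_mem_nhdsGE_of_mem ht))
    (fun t ht => (hz t ht).continuousWithinAt)
    (fun t ht => (hz t ⟨ht.1, ht.2.le⟩).mono_of_mem_nhdsWithin (Icc_mem_nhdsGE_of_mem ht)) h0

theorem IsForwardTrajectory.eq (hv : LipschitzWith K v) {y z : ℝ → E}
    (hy : IsForwardTrajectory v y) (hz : IsForwardTrajectory v z) (h0 : y 0 = z 0)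
    {t : ℝ} (ht : 0 ≤ t) : y t = z t :=
  eqOn_Icc_of_hasDerivWithinAt hv (T := t)
    (fun s hs => (hy s hs.1).mono Icc_subset_Ici_self)
    (fun s hs => (hz s hs.1).mono Icc_subset_Ici_self) h0 ⟨ht, le_rfl⟩

theorem IsForwardTrajectory.shift {z : ℝ → E} (hz : IsForwardTrajectory v z) {s : ℝ}
    (hs : 0 ≤ s) : IsForwardTrajectory v (fun t => z (t + s)) := by
  intro t ht
  have h1 := hz (t + s) (by positivity)
  have h2 : HasDerivWithinAt (fun t : ℝ => t + s) 1 (Ici 0) t :=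
    (hasDerivAt_id t).add_const s |>.hasDerivWithinAt
  have h3 := HasDerivWithinAt.scomp t h1 h2 (fun r (hr : 0 ≤ r) => add_nonneg hr hs)
  rwa [one_smul] at h3

/-- A bounded globally Lipschitz field has forward trajectories from every point: boundedness lets
the Picard-Lindelöf theorem run on `[0, n]` for every `n`, and uniqueness glues the pieces. -/
theorem exists_isForwardTrajectory [CompleteSpace E] (hv : LipschitzWith K v)
    (hL : ∀ x, ‖v x‖ ≤ L) (x : E) : ∃ z, IsForwardTrajectory v z ∧ z 0 = x := by
  have key : ∀ n : ℕ, ∃ α : ℝ → E, α 0 = x ∧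
      ∀ t ∈ Icc (0 : ℝ) n, HasDerivWithinAt α (v (α t)) (Icc 0 n) t := by
    intro n
    have hPL : IsPicardLindelof (fun _ : ℝ => v) (tmin := 0) (tmax := n)
        ⟨0, le_rfl, n.cast_nonneg⟩ x (L * n) 0 L K :=
      { lipschitzOnWith := fun _ _ => hv.lipschitzOnWith
        continuousOn := fun _ _ => continuousOn_const
        norm_le := fun _ _ y _ => hL y
        mul_max_le := by simp }
    exact hPL.exists_eq_forall_mem_Icc_hasDerivWithinAt₀
  choose α hα0 hα using key
  have agree : ∀ {m n : ℕ}, m ≤ n → EqOn (α m) (α n) (Icc 0 m) := by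
    intro m n hmn
    refine eqOn_Icc_of_hasDerivWithinAt hv (hα m) (fun t ht => ?_) ((hα0 m).trans (hα0 n).symm)
    have hmn' : (m : ℝ) ≤ n := by exact_mod_cast hmn
    exact (hα n t ⟨ht.1, ht.2.trans hmn'⟩).mono (Icc_subset_Icc_right hmn')
  have glue : ∀ {n : ℕ} {t : ℝ}, t ∈ Icc (0 : ℝ) n → α ⌈t⌉₊ t = α n t := fun {n t} ht =>
    agree (Nat.ceil_le.2 ht.2) ⟨ht.1, Nat.le_ceil t⟩
  refine ⟨fun t => α ⌈t⌉₊ t, fun t ht => ?_, by simp [hα0]⟩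
  have hlt : t < ((⌈t⌉₊ + 1 : ℕ) : ℝ) := (Nat.le_ceil t).trans_lt (by push_cast; linarith)
  set n : ℕ := ⌈t⌉₊ + 1
  have hmem : t ∈ Icc (0 : ℝ) n := ⟨ht, hlt.le⟩
  have h1 := HasDerivWithinAt.congr (hα n t hmem) (f₁ := fun t => α ⌈t⌉₊ t) (fun s hs => glue hs)
    (glue hmem)
  rw [← glue hmem] at h1
  refine h1.mono_of_mem_nhdsWithin ?_
  rw [← Ici_inter_Iic]
  exact inter_mem_nhdsWithin _ (Iic_mem_nhds hlt)

/-- The time-one map of `v`: the value at time `1` of a forward trajectory starting at the given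
point. -/
noncomputable def timeOneMap [CompleteSpace E] (hv : LipschitzWith K v)
    (hL : ∀ x, ‖v x‖ ≤ L) (x : E) : E :=
  (exists_isForwardTrajectory hv hL x).choose 1

theorem IsForwardTrajectory.timeOneMap_eq [CompleteSpace E] (hv : LipschitzWith K v)
    (hL : ∀ x, ‖v x‖ ≤ L) {z : ℝ → E} (hz : IsForwardTrajectory v z) :
    timeOneMap hv hL (z 0) = z 1 :=
  have h := (exists_isForwardTrajectory hv hL (z 0)).choose_spec
  h.1.eq hv hz h.2 zero_le_one

theorem IsForwardTrajectory.iterate_timeOneMap [CompleteSpace E] (hv : LipschitzWith K v)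
    (hL : ∀ x, ‖v x‖ ≤ L) {z : ℝ → E} (hz : IsForwardTrajectory v z) (n : ℕ) :
    (timeOneMap hv hL)^[n] (z 0) = z n := by
  induction n with
  | zero => simp
  | succ n ih =>
    rw [Function.iterate_succ_apply', ih]
    have h := (hz.shift n.cast_nonneg).timeOneMap_eq hv hL
    simpa [add_comm] using h

theorem IsForwardTrajectory.norm_sub_le (hL : ∀ x, ‖v x‖ ≤ L) {z : ℝ → E}
    (hz : IsForwardTrajectory v z) {s t : ℝ} (hs : 0 ≤ s) (hst : s ≤ t) :
    ‖z t - z s‖ ≤ L * (t - s) :=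
  norm_image_sub_le_of_norm_deriv_le_segment' (f' := fun r => v (z r))
    (fun r hr => (hz r (hs.trans hr.1)).mono (fun _ hq => hs.trans hq.1))
    (fun _ _ => hL _) t ⟨hst, le_rfl⟩

/-- One explicit Euler step with slope `w` errs by at most `C h` if the derivative stays within
distance `C` of `w`. -/
theorem norm_sub_euler_le {z z' : ℝ → E} {a h C : ℝ} {w : E} (hh : 0 ≤ h)
    (hz : ∀ t ∈ Icc a (a + h), HasDerivWithinAt z (z' t) (Icc a (a + h)) t)
    (hC : ∀ t ∈ Icc a (a + h), ‖z' t - w‖ ≤ C) :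
    ‖z (a + h) - (z a + h • w)‖ ≤ C * h := by
  have hd : ∀ t ∈ Icc a (a + h),
      HasDerivWithinAt (fun t => z t - t • w) (z' t - w) (Icc a (a + h)) t := by
    intro t ht
    have h2 : HasDerivWithinAt (fun t : ℝ => t • w) ((1 : ℝ) • w) (Icc a (a + h)) t :=
      ((hasDerivAt_id t).smul_const w).hasDerivWithinAt
    rw [one_smul] at h2
    exact (hz t ht).sub h2
  have := norm_image_sub_le_of_norm_deriv_le_segment' hd
    (fun t ht => hC t (Ico_subset_Icc_self ht)) (a + h) ⟨by linarith, le_rfl⟩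
  rw [add_sub_cancel_left] at this
  convert this using 2
  rw [add_smul]
  abel

end Trajectory

/-! ### Limits of measure-preserving maps -/

/-- A uniform limit of measure-preserving maps is measure-preserving: preimages of a compact set
under the limit are compared with preimages of its thickenings under the approximating maps. -/
theorem measurePreserving_of_tendstoUniformly {α : Type*} [MetricSpace α] [ProperSpace α]
    [MeasurableSpace α] [BorelSpace α] {μ : Measure α} [IsFiniteMeasureOnCompacts μ]
    {F : ℕ → α → α} {φ : α → α} (hF : ∀ n, MeasurePreserving (F n) μ μ) (hφ : Continuous φ)
    (h : TendstoUniformly F φ atTop) : MeasurePreserving φ μ μ := by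
  have hthick : ∀ {A : Set α} {r : ℝ}, MeasurableSet A → 0 < r →
      μ (φ ⁻¹' A) ≤ μ (Metric.cthickening r A) ∧ μ A ≤ μ (φ ⁻¹' Metric.cthickening r A) := by
    intro A r hA hr
    obtain ⟨n, hn⟩ := (Metric.tendstoUniformly_iff.1 h r hr).exists
    constructor
    · rw [← (hF n).measure_preimage Metric.isClosed_cthickening.measurableSet.nullMeasurableSet]
      refine measure_mono fun x hx => ?_
      exact Metric.mem_cthickening_of_dist_le _ (φ x) _ _ hx (by rw [dist_comm]; exact (hn x).le)
    · rw [← (hF n).measure_preimage hA.nullMeasurableSet]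
      refine measure_mono fun x hx => ?_
      exact Metric.mem_cthickening_of_dist_le _ (F n x) _ _ hx (hn x).le
  have hcompact_le : ∀ {A : Set α}, IsCompact A → μ (φ ⁻¹' A) ≤ μ A := by
    intro A hA
    refine ge_of_tendsto ((tendsto_measure_cthickening_of_isCompact (μ := μ) hA).mono_left
      (nhdsWithin_le_nhds (s := Ioi 0))) ?_
    filter_upwards [self_mem_nhdsWithin] with r hr
    exact (hthick hA.measurableSet hr).1
  have hcompact_ge : ∀ {A : Set α}, IsCompact A → μ A ≤ μ (φ ⁻¹' A) := by
    intro A hA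
    -- The measure `μ ∘ φ⁻¹` is finite on compact sets, so thickenings can be used for it too.
    have : IsFiniteMeasureOnCompacts (μ.map φ) := ⟨fun B hB => by
      rw [Measure.map_apply hφ.measurable hB.measurableSet]
      exact (hcompact_le hB).trans_lt hB.measure_lt_top⟩
    have ht := (tendsto_measure_cthickening_of_isCompact (μ := μ.map φ) hA).mono_left
      (nhdsWithin_le_nhds (s := Ioi 0))
    rw [Measure.map_apply hφ.measurable hA.measurableSet] at ht
    refine ge_of_tendsto ht ?_
    filter_upwards [self_mem_nhdsWithin] with r hr
    rw [Measure.map_apply hφ.measurable Metric.isClosed_cthickening.measurableSet]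
    exact (hthick hA.measurableSet hr).2
  refine ⟨hφ.measurable, ?_⟩
  rcases isEmpty_or_nonempty α with hα | ⟨⟨x₀⟩⟩
  · ext s
    simp [Set.eq_empty_of_isEmpty s]
  refine Measure.ext_of_generateFrom_of_iUnion {s | IsClosed s}
    (fun n : ℕ => Metric.closedBall x₀ n)
    (by rw [← borel_eq_generateFrom_isClosed]; exact BorelSpace.measurable_eq)
    isPiSystem_isClosed (Metric.iUnion_closedBall_nat x₀) (fun n => Metric.isClosed_closedBall)
    (fun n => ?_) (fun s hs => ?_)
  · rw [Measure.map_apply hφ.measurable Metric.isClosed_closedBall.measurableSet]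
    exact ((hcompact_le (isCompact_closedBall _ _)).trans_lt
      (isCompact_closedBall _ _).measure_lt_top).ne
  · rw [Measure.map_apply hφ.measurable (IsClosed.measurableSet hs)]
    have hs' : s = ⋃ n : ℕ, s ∩ Metric.closedBall x₀ n := by
      rw [← inter_iUnion, Metric.iUnion_closedBall_nat, inter_univ]
    have hmono : Monotone fun n : ℕ => s ∩ Metric.closedBall x₀ n := fun m n hmn =>
      inter_subset_inter_right _ (Metric.closedBall_subset_closedBall (by exact_mod_cast hmn))
    rw [hs', preimage_iUnion, hmono.measure_iUnion, Monotone.measure_iUnion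
      (fun m n hmn => preimage_mono (hmono hmn))]
    refine iSup_congr fun n => ?_
    have hc : IsCompact (s ∩ Metric.closedBall x₀ n) :=
      (isCompact_closedBall _ _).inter_left hs
    exact le_antisymm (hcompact_le hc) (hcompact_ge hc)

/-! ### Liouville's theorem for separable Lipschitz fields -/

section Separable

variable {E₁ E₂ : Type*} [NormedAddCommGroup E₁] [NormedAddCommGroup E₂]
  {f : E₂ → E₁} {g : E₁ → E₂} {K L : ℝ≥0}

/-- The separable vector field `(z₁, z₂) ↦ (f z₂, g z₁)`, in which neither component depends on its
own variable, so that it is formally divergence-free. -/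
def separableField (f : E₂ → E₁) (g : E₁ → E₂) (z : E₁ × E₂) : E₁ × E₂ := (f z.2, g z.1)

theorem lipschitzWith_separableField (hf : LipschitzWith K f) (hg : LipschitzWith K g) :
    LipschitzWith K (separableField f g) := by
  refine LipschitzWith.of_dist_le_mul fun x y => ?_
  rw [Prod.dist_eq]
  refine max_le ((hf.dist_le_mul _ _).trans ?_) ((hg.dist_le_mul _ _).trans ?_)
  · exact mul_le_mul_of_nonneg_left (le_max_right _ _) K.2
  · exact mul_le_mul_of_nonneg_left (le_max_left _ _) K.2

theorem norm_separableField_le (hf : ∀ y, ‖f y‖ ≤ L) (hg : ∀ x, ‖g x‖ ≤ L) (z : E₁ × E₂) :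
    ‖separableField f g z‖ ≤ L :=
  max_le (hf _) (hg _)

variable [NormedSpace ℝ E₁] [NormedSpace ℝ E₂]

/-- The symplectic Euler step of size `h` for `separableField f g`: the second component moves with
the already updated first one, so that the step is a composition of two shears. -/
def symplecticEuler (f : E₂ → E₁) (g : E₁ → E₂) (h : ℝ) (z : E₁ × E₂) : E₁ × E₂ :=
  (z.1 + h • f z.2, z.2 + h • g (z.1 + h • f z.2))

theorem measurePreserving_symplecticEuler [MeasurableSpace E₁] [BorelSpace E₁]
    [SecondCountableTopology E₁] [MeasurableSpace E₂] [BorelSpace E₂] [SecondCountableTopology E₂]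
    (μ₁ : Measure E₁) (μ₂ : Measure E₂) [SFinite μ₁] [SFinite μ₂] [μ₁.IsAddLeftInvariant]
    [μ₂.IsAddLeftInvariant] (hf : Continuous f) (hg : Continuous g) (h : ℝ) :
    MeasurePreserving (symplecticEuler f g h) (μ₁.prod μ₂) (μ₁.prod μ₂) := by
  have shear₂ : MeasurePreserving (fun z : E₁ × E₂ => (z.1, h • g z.1 + z.2))
      (μ₁.prod μ₂) (μ₁.prod μ₂) :=
    (MeasurePreserving.id μ₁).skew_product (g := fun x y => h • g x + y)
      (by fun_prop) (Eventually.of_forall fun x => map_add_left_eq_self μ₂ _)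
  have shear₁ : MeasurePreserving (fun z : E₂ × E₁ => (z.1, h • f z.1 + z.2))
      (μ₂.prod μ₁) (μ₂.prod μ₁) :=
    (MeasurePreserving.id μ₂).skew_product (g := fun x y => h • f x + y)
      (by fun_prop) (Eventually.of_forall fun x => map_add_left_eq_self μ₁ _)
  have swap₁ : MeasurePreserving (Prod.swap : E₁ × E₂ → E₂ × E₁) (μ₁.prod μ₂) (μ₂.prod μ₁) :=
    Measure.measurePreserving_swap
  have swap₂ : MeasurePreserving (Prod.swap : E₂ × E₁ → E₁ × E₂) (μ₂.prod μ₁) (μ₁.prod μ₂) :=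
    Measure.measurePreserving_swap
  convert shear₂.comp (swap₂.comp (shear₁.comp swap₁)) using 1
  funext z
  simp [symplecticEuler, add_comm]

theorem continuous_symplecticEuler (hf : Continuous f) (hg : Continuous g) (h : ℝ) :
    Continuous (symplecticEuler f g h) := by
  unfold symplecticEuler
  fun_prop

theorem norm_symplecticEuler_sub_le (hf : LipschitzWith K f) (hg : LipschitzWith K g) {h : ℝ}
    (hh : 0 ≤ h) (x y : E₁ × E₂) :
    ‖symplecticEuler f g h x - symplecticEuler f g h y‖ ≤ (1 + K * h) ^ 2 * ‖x - y‖ := by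
  have hK : (0 : ℝ) ≤ K * h := mul_nonneg K.2 hh
  have h1 : ‖(x.1 + h • f x.2) - (y.1 + h • f y.2)‖ ≤ (1 + K * h) * ‖x - y‖ := by
    calc ‖(x.1 + h • f x.2) - (y.1 + h • f y.2)‖
        = ‖(x - y).1 + h • (f x.2 - f y.2)‖ := by
          rw [smul_sub, Prod.fst_sub]; congr 1; abel
      _ ≤ ‖(x - y).1‖ + ‖h • (f x.2 - f y.2)‖ := norm_add_le _ _
      _ ≤ ‖x - y‖ + h * (K * ‖x - y‖) := by
          rw [norm_smul, Real.norm_of_nonneg hh]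
          have := (hf.norm_sub_le x.2 y.2).trans
            (mul_le_mul_of_nonneg_left (norm_snd_le (x - y)) K.2)
          gcongr
          exact norm_fst_le _
      _ = _ := by ring
  have h2 : ‖(x.2 + h • g (x.1 + h • f x.2)) - (y.2 + h • g (y.1 + h • f y.2))‖
      ≤ (1 + K * h) ^ 2 * ‖x - y‖ := by
    calc ‖(x.2 + h • g (x.1 + h • f x.2)) - (y.2 + h • g (y.1 + h • f y.2))‖
        = ‖(x - y).2 + h • (g (x.1 + h • f x.2) - g (y.1 + h • f y.2))‖ := by
          rw [smul_sub, Prod.snd_sub]; congr 1; abel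
      _ ≤ ‖(x - y).2‖ + ‖h • (g (x.1 + h • f x.2) - g (y.1 + h • f y.2))‖ := norm_add_le _ _
      _ ≤ ‖x - y‖ + h * (K * ((1 + K * h) * ‖x - y‖)) := by
          rw [norm_smul, Real.norm_of_nonneg hh]
          have := (hg.norm_sub_le (x.1 + h • f x.2) (y.1 + h • f y.2)).trans
            (mul_le_mul_of_nonneg_left h1 K.2)
          gcongr
          exact norm_snd_le _
      _ ≤ (1 + K * h) ^ 2 * ‖x - y‖ := by
          have : 0 ≤ K * h * ‖x - y‖ := by positivity
          nlinarith
  refine max_le (h1.trans ?_) h2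
  refine mul_le_mul_of_nonneg_right ?_ (norm_nonneg _)
  nlinarith

/-- The symplectic Euler step has a quadratic local error. -/
theorem IsForwardTrajectory.norm_sub_symplecticEuler_le (hf : LipschitzWith K f)
    (hg : LipschitzWith K g) (hfL : ∀ y, ‖f y‖ ≤ L) (hgL : ∀ x, ‖g x‖ ≤ L) {z : ℝ → E₁ × E₂}
    (hz : IsForwardTrajectory (separableField f g) z) {s h : ℝ} (hs : 0 ≤ s) (hh : 0 ≤ h) :
    ‖z (s + h) - symplecticEuler f g h (z s)‖ ≤ 2 * K * L * h ^ 2 := by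
  have hsub : Icc s (s + h) ⊆ Ici 0 := fun r hr => hs.trans hr.1
  have hdist : ∀ t ∈ Icc s (s + h), ‖z t - z s‖ ≤ L * h := fun t ht =>
    (hz.norm_sub_le (norm_separableField_le hfL hgL) hs ht.1).trans
      (mul_le_mul_of_nonneg_left (by linarith [ht.2]) L.2)
  have hKL : (0 : ℝ) ≤ K * L * h := by positivity
  have e1 : ‖(z (s + h)).1 - ((z s).1 + h • f (z s).2)‖ ≤ (K * (L * h)) * h := by
    refine norm_sub_euler_le (z := fun t => (z t).1) (z' := fun t => f (z t).2) hh
      (fun t ht => ?_) (fun t ht => ?_)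
    · exact HasFDerivWithinAt.hasDerivWithinAt (hasFDerivAt_fst.comp_hasFDerivWithinAt t
        ((hz t (hsub ht)).mono hsub).hasFDerivWithinAt) |>.congr_deriv (by simp [separableField])
    · exact (hf.norm_sub_le _ _).trans (mul_le_mul_of_nonneg_left
        ((norm_snd_le (z t - z s)).trans (hdist t ht)) K.2)
  have e2 : ‖(z (s + h)).2 - ((z s).2 + h • g ((z s).1 + h • f (z s).2))‖
      ≤ (K * (2 * (L * h))) * h := by
    refine norm_sub_euler_le (z := fun t => (z t).2) (z' := fun t => g (z t).1) hh
      (fun t ht => ?_) (fun t ht => ?_)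
    · exact HasFDerivWithinAt.hasDerivWithinAt (hasFDerivAt_snd.comp_hasFDerivWithinAt t
        ((hz t (hsub ht)).mono hsub).hasFDerivWithinAt) |>.congr_deriv (by simp [separableField])
    · refine (hg.norm_sub_le _ _).trans (mul_le_mul_of_nonneg_left ?_ K.2)
      calc ‖(z t).1 - ((z s).1 + h • f (z s).2)‖
          = ‖(z t - z s).1 - h • f (z s).2‖ := by rw [Prod.fst_sub, sub_sub]
        _ ≤ ‖(z t - z s).1‖ + ‖h • f (z s).2‖ := _root_.norm_sub_le _ _
        _ ≤ L * h + h * L := by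
            rw [norm_smul, Real.norm_of_nonneg hh]
            gcongr
            · exact (norm_fst_le _).trans (hdist t ht)
            · exact hfL _
        _ = 2 * (L * h) := by ring
  refine max_le (e1.trans ?_) (e2.trans ?_) <;> nlinarith

/-- Discrete Grönwall estimate for the global error of the symplectic Euler scheme. -/
theorem IsForwardTrajectory.norm_sub_iterate_symplecticEuler_le (hf : LipschitzWith K f)
    (hg : LipschitzWith K g) (hfL : ∀ y, ‖f y‖ ≤ L) (hgL : ∀ x, ‖g x‖ ≤ L) {z : ℝ → E₁ × E₂}
    (hz : IsForwardTrajectory (separableField f g) z) {h : ℝ} (hh : 0 ≤ h) (k : ℕ) :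
    ‖z (k * h) - (symplecticEuler f g h)^[k] (z 0)‖
      ≤ k * (2 * K * L * h ^ 2) * ((1 + K * h) ^ 2) ^ k := by
  induction k with
  | zero => simp
  | succ k ih =>
    have hA : (1 : ℝ) ≤ (1 + K * h) ^ 2 := one_le_pow₀ (by nlinarith [mul_nonneg K.2 hh])
    have hD : (0 : ℝ) ≤ 2 * K * L * h ^ 2 := by positivity
    set A : ℝ := (1 + K * h) ^ 2
    set D : ℝ := 2 * K * L * h ^ 2
    have hloc := hz.norm_sub_symplecticEuler_le hf hg hfL hgL
      (mul_nonneg k.cast_nonneg hh) hh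
    have hlip := norm_symplecticEuler_sub_le hf hg hh (z (k * h))
      ((symplecticEuler f g h)^[k] (z 0))
    have hcast : ((k + 1 : ℕ) : ℝ) * h = k * h + h := by push_cast; ring
    rw [hcast, Function.iterate_succ_apply']
    calc _ ≤ D + A * (k * D * A ^ k) := by
          refine (norm_sub_le_norm_sub_add_norm_sub _
            (symplecticEuler f g h (z (k * h))) _).trans (add_le_add hloc (hlip.trans ?_))
          exact mul_le_mul_of_nonneg_left ih (by positivity)
      _ ≤ D * A ^ (k + 1) + A * (k * D * A ^ k) := by
          have := mul_le_mul_of_nonneg_left (one_le_pow₀ hA (n := k + 1)) hD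
          linarith
      _ = _ := by push_cast; ring

/-- Liouville's theorem in the absence of smoothness: the iterated symplectic Euler steps are
volume-preserving and converge uniformly to the time-one map. -/
theorem measurePreserving_timeOneMap [FiniteDimensional ℝ E₁] [FiniteDimensional ℝ E₂]
    [MeasurableSpace E₁] [BorelSpace E₁] [MeasurableSpace E₂] [BorelSpace E₂]
    [CompleteSpace (E₁ × E₂)]
    (μ₁ : Measure E₁) (μ₂ : Measure E₂) [μ₁.IsAddHaarMeasure] [μ₂.IsAddHaarMeasure]
    (hf : LipschitzWith K f) (hg : LipschitzWith K g)
    (hfL : ∀ y, ‖f y‖ ≤ L) (hgL : ∀ x, ‖g x‖ ≤ L) :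
    MeasurePreserving (timeOneMap (lipschitzWith_separableField hf hg)
      (norm_separableField_le hfL hgL)) (μ₁.prod μ₂) (μ₁.prod μ₂) := by
  have := FiniteDimensional.proper_real E₁
  have := FiniteDimensional.proper_real E₂
  set φ := timeOneMap (lipschitzWith_separableField hf hg) (norm_separableField_le hfL hgL)
  set F : ℕ → E₁ × E₂ → E₁ × E₂ := fun n => (symplecticEuler f g (1 / (n + 1 : ℕ)))^[n + 1]
  have hbound : ∀ n x, dist (φ x) (F n x) ≤
      2 * K * L * Real.exp (2 * K) * (1 / ((n : ℝ) + 1)) := by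
    intro n x
    obtain ⟨z, hz, rfl⟩ := exists_isForwardTrajectory (lipschitzWith_separableField hf hg)
      (norm_separableField_le hfL hgL) x
    have hn : (0 : ℝ) < (n + 1 : ℕ) := by positivity
    have he := hz.norm_sub_iterate_symplecticEuler_le hf hg hfL hgL
      (one_div_nonneg.2 hn.le) (n + 1)
    rw [mul_one_div_cancel hn.ne'] at he
    rw [dist_eq_norm, show φ (z 0) = z 1 from hz.timeOneMap_eq _ _]
    refine he.trans ?_
    have hexp : ((1 + K * (1 / ((n + 1 : ℕ) : ℝ))) ^ 2) ^ (n + 1) ≤ Real.exp (2 * K) := by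
      have h1 : 1 + (K : ℝ) * (1 / ((n + 1 : ℕ) : ℝ)) ≤ Real.exp (K * (1 / ((n + 1 : ℕ) : ℝ))) := by
        rw [add_comm]; exact Real.add_one_le_exp _
      calc _ ≤ (Real.exp (K * (1 / ((n + 1 : ℕ) : ℝ))) ^ 2) ^ (n + 1) := by gcongr
        _ = Real.exp (2 * K) := by
          rw [← pow_mul, ← Real.exp_nat_mul]
          congr 1
          push_cast
          field_simp
    calc _ ≤ ((n + 1 : ℕ) : ℝ) * (2 * K * L * (1 / ((n + 1 : ℕ) : ℝ)) ^ 2) * Real.exp (2 * K) := by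
          gcongr
      _ = _ := by push_cast; field_simp
  have hunif : TendstoUniformly F φ atTop := by
    rw [Metric.tendstoUniformly_iff]
    intro ε hε
    have hlim := (tendsto_one_div_add_atTop_nhds_zero_nat (𝕜 := ℝ)).const_mul
      (2 * K * L * Real.exp (2 * K))
    rw [mul_zero] at hlim
    filter_upwards [hlim.eventually_lt_const hε] with n hn x
    exact (hbound n x).trans_lt hn
  refine measurePreserving_of_tendstoUniformly (fun n => ?_) (hunif.continuous ?_) hunif
  · exact (measurePreserving_symplecticEuler μ₁ μ₂ hf.continuous hg.continuous _).iterate _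
  · exact Frequently.of_forall fun n =>
      (continuous_symplecticEuler hf.continuous hg.continuous _).iterate _

/-- Poincaré recurrence for separable Lipschitz fields with a conserved quantity whose sublevel
sets are bounded: almost every trajectory returns to its starting point along integer times. -/
theorem ae_exists_recurrent [FiniteDimensional ℝ E₁] [FiniteDimensional ℝ E₂]
    [MeasurableSpace E₁] [BorelSpace E₁] [MeasurableSpace E₂] [BorelSpace E₂]
    (μ₁ : Measure E₁) (μ₂ : Measure E₂) [μ₁.IsAddHaarMeasure] [μ₂.IsAddHaarMeasure]
    (hf : LipschitzWith K f) (hg : LipschitzWith K g)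
    (hfL : ∀ y, ‖f y‖ ≤ L) (hgL : ∀ x, ‖g x‖ ≤ L) {F : E₁ × E₂ → ℝ} (hF : Continuous F)
    (hFb : ∀ c, Bornology.IsBounded {z | F z < c})
    (hinv : ∀ z, IsForwardTrajectory (separableField f g) z → ∀ t, 0 ≤ t → F (z t) = F (z 0)) :
    ∀ᵐ x ∂(μ₁.prod μ₂), ∀ z, IsForwardTrajectory (separableField f g) z → z 0 = x →
      ∃ τ : ℕ → ℕ, StrictMono τ ∧ Tendsto (fun n => z (τ n)) atTop (𝓝 (z 0)) := by
  have := FiniteDimensional.proper_real E₁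
  have := FiniteDimensional.proper_real E₂
  have := FiniteDimensional.complete ℝ (E₁ × E₂)
  set φ := timeOneMap (lipschitzWith_separableField hf hg) (norm_separableField_le hfL hgL)
  have hφ : MeasurePreserving φ (μ₁.prod μ₂) (μ₁.prod μ₂) :=
    measurePreserving_timeOneMap μ₁ μ₂ hf hg hfL hgL
  have hFφ : ∀ x, F (φ x) = F x := by
    intro x
    obtain ⟨z, hz, rfl⟩ := exists_isForwardTrajectory (lipschitzWith_separableField hf hg)
      (norm_separableField_le hfL hgL) x
    rw [show φ (z 0) = z 1 from hz.timeOneMap_eq _ _]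
    exact hinv z hz 1 zero_le_one
  have hrec : ∀ n : ℕ, ∀ᵐ x ∂(μ₁.prod μ₂), F x < n → ∀ s ∈ 𝓝 x, ∃ᶠ k in atTop, φ^[k] x ∈ s := by
    intro n
    have hmeas : MeasurableSet {x | F x < n} := (isOpen_Iio.preimage hF).measurableSet
    have hpre : φ ⁻¹' {x | F x < n} = {x | F x < n} := by
      ext x
      simp [hFφ]
    have hres := hφ.restrict_preimage hmeas
    rw [hpre] at hres
    have : IsFiniteMeasure ((μ₁.prod μ₂).restrict {x | F x < n}) :=
      ⟨by rw [Measure.restrict_apply_univ]; exact (hFb n).measure_lt_top⟩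
    exact (ae_restrict_iff' hmeas).1 hres.conservative.ae_frequently_mem_of_mem_nhds
  filter_upwards [ae_all_iff.2 hrec] with x hx z hz hzx
  obtain ⟨n, hn⟩ := exists_nat_gt (F x)
  have hclus : MapClusterPt x atTop fun k : ℕ => z k := by
    rw [mapClusterPt_iff_frequently]
    intro s hs
    refine (hx n hn s hs).mono fun k hk => ?_
    rwa [← hzx, hz.iterate_timeOneMap] at hk
  rw [hzx]
  exact hclus.tendsto_subseq

end Separable

/-! ### Rank-one projections and spectral decompositions in `Herm d` -/

namespace Herm

variable {d : ℕ}

/-- The rank-one Hermitian matrix `|x⟩⟨x|`. -/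
noncomputable def rankOne (x : EuclideanSpace ℂ (Fin d)) : Herm d :=
  ⟨Matrix.vecMulVec x.ofLp (star x.ofLp), by
    change Matrix.IsHermitian _
    exact Matrix.IsHermitian.ext fun i j => by simp [Matrix.vecMulVec_apply, mul_comm]⟩

theorem inner_rankOne (X : Herm d) (x : EuclideanSpace ℂ (Fin d)) :
    inner ℝ X (rankOne x) = (star x.ofLp ⬝ᵥ (X.mat *ᵥ x.ofLp)).re := by
  rw [inner_eq, tracePairing]
  change (X.mat * Matrix.vecMulVec x.ofLp (star x.ofLp)).trace.re = _
  rw [Matrix.mul_vecMulVec, Matrix.trace_vecMulVec, dotProduct_comm]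

theorem inner_rankOne_rankOne (x y : EuclideanSpace ℂ (Fin d)) :
    inner ℝ (rankOne x) (rankOne y) = ‖inner ℂ x y‖ ^ 2 := by
  rw [inner_rankOne]
  change (star y.ofLp ⬝ᵥ (Matrix.vecMulVec x.ofLp (star x.ofLp) *ᵥ y.ofLp)).re = _
  rw [Matrix.vecMulVec_mulVec, dotProduct_smul]
  have h1 : star x.ofLp ⬝ᵥ y.ofLp = inner ℂ x y := by
    rw [EuclideanSpace.inner_eq_star_dotProduct, dotProduct_comm]
  have h2 : star y.ofLp ⬝ᵥ x.ofLp = inner ℂ y x := by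
    rw [EuclideanSpace.inner_eq_star_dotProduct, dotProduct_comm]
  rw [h1, h2, ← inner_conj_symm y x]
  simp only [MulOpposite.smul_eq_mul_unop, MulOpposite.unop_op]
  rw [mul_comm, Complex.mul_conj, Complex.ofReal_re, Complex.normSq_eq_norm_sq]

theorem norm_rankOne (x : EuclideanSpace ℂ (Fin d)) : ‖rankOne x‖ = ‖x‖ ^ 2 := by
  have h := inner_rankOne_rankOne x x
  rw [real_inner_self_eq_norm_sq, inner_self_eq_norm_sq_to_K] at h
  simp only [Complex.coe_algebraMap, norm_pow, Complex.norm_real, norm_norm] at h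
  exact (pow_left_inj₀ (norm_nonneg _) (by positivity) two_ne_zero).1 h

theorem posSemidef_iff {X : Herm d} : X.mat.PosSemidef ↔ ∀ x, 0 ≤ inner ℝ X (rankOne x) := by
  simp only [inner_rankOne]
  constructor
  · intro h x
    exact (Complex.le_def.1 (h.dotProduct_mulVec_nonneg x.ofLp)).1
  · intro h
    refine Matrix.PosSemidef.of_dotProduct_mulVec_nonneg X.isHermitian fun x => ?_
    refine Complex.le_def.2 ⟨h (WithLp.toLp 2 x), ?_⟩
    simpa using (X.isHermitian.im_star_dotProduct_mulVec_self x).symm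

theorem eq_sum_eigenvalues_smul_rankOne (X : Herm d) :
    X = ∑ j, X.isHermitian.eigenvalues j • rankOne (X.isHermitian.eigenvectorBasis j) := by
  have hsum : ∀ (s : Finset (Fin d)) (f : Fin d → Herm d),
      (∑ j ∈ s, f j).mat = ∑ j ∈ s, (f j).mat := fun s f =>
    map_sum (AddMonoidHom.mk' (fun Y : Herm d => Y.mat) mat_add) f s
  refine Subtype.ext (Matrix.ext fun a b => ?_)
  change X.mat a b = (∑ j, X.isHermitian.eigenvalues j •
    rankOne (X.isHermitian.eigenvectorBasis j)).mat a b
  rw [hsum, Matrix.sum_apply]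
  conv_lhs => rw [X.isHermitian.spectral_theorem, Unitary.conjStarAlgAut_apply]
  rw [Matrix.mul_apply]
  simp only [Matrix.mul_diagonal, Matrix.star_apply,
    Matrix.IsHermitian.eigenvectorUnitary_apply, Function.comp_apply]
  refine Finset.sum_congr rfl fun j _ => ?_
  change _ = (X.isHermitian.eigenvalues j • Matrix.vecMulVec
    (X.isHermitian.eigenvectorBasis j).ofLp (star (X.isHermitian.eigenvectorBasis j).ofLp)) a b
  simp only [Matrix.smul_apply, Matrix.vecMulVec_apply, Pi.star_apply, Complex.real_smul]
  simp only [Complex.coe_algebraMap]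
  ring

theorem inner_rankOne_eq_sum (X : Herm d) (x : EuclideanSpace ℂ (Fin d)) :
    inner ℝ X (rankOne x) = ∑ j, ‖inner ℂ (X.isHermitian.eigenvectorBasis j) x‖ ^ 2 *
      X.isHermitian.eigenvalues j := by
  conv_lhs => rw [eq_sum_eigenvalues_smul_rankOne X]
  rw [sum_inner]
  refine Finset.sum_congr rfl fun j _ => ?_
  rw [real_inner_smul_left, inner_rankOne_rankOne, mul_comm]

theorem inner_rankOne_eigenvectorBasis (X : Herm d) (j : Fin d) :
    inner ℝ X (rankOne (X.isHermitian.eigenvectorBasis j)) = X.isHermitian.eigenvalues j := by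
  rw [inner_rankOne, X.isHermitian.eigenvalues_eq]
  rfl

theorem norm_sq_eq_sum (X : Herm d) : ‖X‖ ^ 2 = ∑ j, X.isHermitian.eigenvalues j ^ 2 := by
  rw [← real_inner_self_eq_norm_sq]
  conv_lhs => enter [3]; rw [eq_sum_eigenvalues_smul_rankOne X]
  rw [inner_sum]
  refine Finset.sum_congr rfl fun j _ => ?_
  rw [real_inner_smul_right, inner_rankOne_eigenvectorBasis, sq]

/-- The trace as a linear functional on `Herm d`. -/
noncomputable def traceLin (d : ℕ) : Herm d →ₗ[ℝ] ℂ where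
  toFun X := X.mat.trace
  map_add' X Y := by simp
  map_smul' r X := by simp

end Herm

/-! ### Density matrices -/

section Density

variable {d : ℕ}

open Herm

theorem eigenvalues_mem_Icc {X : Herm d} (hX : X ∈ densityMatrices d) (j : Fin d) :
    X.isHermitian.eigenvalues j ∈ Icc (0 : ℝ) 1 := by
  have hnn : ∀ i, 0 ≤ X.isHermitian.eigenvalues i := fun i => hX.1.eigenvalues_nonneg i
  refine ⟨hnn j, ?_⟩
  have htr : ∑ i, X.isHermitian.eigenvalues i = 1 := by
    have h := X.isHermitian.trace_eq_sum_eigenvalues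
    rw [hX.2] at h
    have h' := congrArg Complex.re h
    simpa using h'.symm
  rw [← htr]
  exact Finset.single_le_sum (fun i _ => hnn i) (Finset.mem_univ j)

theorem convex_densityMatrices (d : ℕ) : Convex ℝ (densityMatrices d) := by
  intro X hX Y hY a b ha hb hab
  refine ⟨posSemidef_iff.2 fun x => ?_, ?_⟩
  · rw [inner_add_left, real_inner_smul_left, real_inner_smul_left]
    have h1 := posSemidef_iff.1 hX.1 x
    have h2 := posSemidef_iff.1 hY.1 x
    positivity
  · change (a • X.mat + b • Y.mat).trace = 1
    rw [Matrix.trace_add, Matrix.trace_smul, Matrix.trace_smul, hX.2, hY.2]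
    simp only [Complex.real_smul, mul_one]
    exact_mod_cast hab

theorem isCompact_densityMatrices (d : ℕ) : IsCompact (densityMatrices d) := by
  refine Metric.isCompact_of_isClosed_isBounded ?_ ?_
  · have : densityMatrices d = (⋂ x, {X : Herm d | 0 ≤ inner ℝ X (rankOne x)}) ∩
        {X | traceLin d X = 1} := by
      ext X
      simp only [densityMatrices, mem_ofPred_eq, mem_inter_iff, mem_iInter, posSemidef_iff]
      rfl
    rw [this]
    refine (isClosed_iInter fun x => isClosed_le continuous_const (by fun_prop)).inter
      (isClosed_eq (traceLin d).continuous_of_finiteDimensional continuous_const)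
  · refine isBounded_iff_forall_norm_le.2 ⟨Real.sqrt d, fun X hX => ?_⟩
    refine Real.le_sqrt_of_sq_le ?_
    rw [norm_sq_eq_sum]
    calc ∑ j, X.isHermitian.eigenvalues j ^ 2 ≤ ∑ _j : Fin d, (1 : ℝ) :=
          Finset.sum_le_sum fun j _ => pow_le_one₀ (eigenvalues_mem_Icc hX j).1
            (eigenvalues_mem_Icc hX j).2
      _ = d := by simp

/-- A density matrix of full rank lies in the interior of the set of density matrices relative to
the affine space of trace-one matrices. -/
theorem exists_add_mem_densityMatrices {X : Herm d} (hX : X ∈ densityMatrices d)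
    (hrank : X.mat.rank = d) :
    ∃ ε > 0, ∀ Z ∈ tracelessHerm d, ‖Z‖ ≤ ε → X + Z ∈ densityMatrices d := by
  have hpos : ∀ j, 0 < X.isHermitian.eigenvalues j := by
    have hcard := X.isHermitian.rank_eq_card_non_zero_eigs
    rw [hrank, Fintype.card_subtype] at hcard
    have huniv := Finset.eq_univ_of_card (Finset.univ.filter
      fun i => X.isHermitian.eigenvalues i ≠ 0) (by rw [← hcard, Fintype.card_fin])
    intro j
    have hj : j ∈ Finset.univ.filter fun i => X.isHermitian.eigenvalues i ≠ 0 := by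
      rw [huniv]; exact Finset.mem_univ j
    exact lt_of_le_of_ne (hX.1.eigenvalues_nonneg j) (Finset.mem_filter.1 hj).2.symm
  obtain ⟨ε, hε, hle⟩ : ∃ ε > 0, ∀ j, ε ≤ X.isHermitian.eigenvalues j := by
    rcases isEmpty_or_nonempty (Fin d) with h | h
    · exact ⟨1, one_pos, fun j => h.elim j⟩
    · obtain ⟨i, hi⟩ := Finite.exists_min X.isHermitian.eigenvalues
      exact ⟨_, hpos i, hi⟩
  refine ⟨ε, hε, fun Z hZ hZε => ⟨posSemidef_iff.2 fun x => ?_, ?_⟩⟩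
  · rw [inner_add_left]
    have h1 : ε * ‖x‖ ^ 2 ≤ inner ℝ X (rankOne x) := by
      rw [inner_rankOne_eq_sum, ← X.isHermitian.eigenvectorBasis.sum_sq_norm_inner_right x,
        Finset.mul_sum]
      refine Finset.sum_le_sum fun j _ => ?_
      rw [mul_comm]
      exact mul_le_mul_of_nonneg_left (hle j) (by positivity)
    have h2 : |inner ℝ Z (rankOne x)| ≤ ε * ‖x‖ ^ 2 := by
      refine (abs_real_inner_le_norm _ _).trans ?_
      rw [norm_rankOne]
      exact mul_le_mul_of_nonneg_right hZε (by positivity)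
    linarith [neg_le_of_abs_le h2]
  · change (X.mat + Z.mat).trace = 1
    have hZ' : Z.mat.trace = 0 := hZ
    rw [Matrix.trace_add, hX.2, hZ', add_zero]

/-! ### Trace regularizers -/

theorem regularizer_eq_sum (θ : ℝ → ℝ) (X : Herm d) :
    regularizer θ X = ∑ j, θ (X.isHermitian.eigenvalues j) := by
  rw [regularizer, Matrix.IsHermitian.cfc, Unitary.conjStarAlgAut_apply, Matrix.trace_mul_comm,
    ← mul_assoc]
  simp [Matrix.trace_diagonal]

theorem regularizer_eq_sum_inner (θ : ℝ → ℝ) (X : Herm d) :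
    regularizer θ X =
      ∑ j, θ (inner ℝ X (rankOne (X.isHermitian.eigenvectorBasis j))) := by
  simp only [regularizer_eq_sum, inner_rankOne_eigenvectorBasis]

theorem inner_rankOne_mem_Icc {X : Herm d} (hX : X ∈ densityMatrices d)
    {x : EuclideanSpace ℂ (Fin d)} (hx : ‖x‖ = 1) : inner ℝ X (rankOne x) ∈ Icc (0 : ℝ) 1 := by
  rw [inner_rankOne_eq_sum]
  exact (convex_Icc (0 : ℝ) 1).sum_mem (t := Finset.univ)
    (w := fun j => ‖inner ℂ (X.isHermitian.eigenvectorBasis j) x‖ ^ 2) (fun j _ => by positivity)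
    (by rw [X.isHermitian.eigenvectorBasis.sum_sq_norm_inner_right, hx, one_pow])
    (fun j _ => eigenvalues_mem_Icc hX j)

/-- Peierls' inequality: by Jensen's inequality and Parseval's identity, the diagonal of `X` in any
orthonormal basis has a smaller `θ`-sum than its spectrum. Together with
`regularizer_eq_sum_inner`, it presents `X ↦ tr θ(X)` as a maximum of sums of `θ` applied to linear
functionals of `X`, which makes it convex and lower semicontinuous along with `θ`. -/
theorem sum_le_regularizer {θ : ℝ → ℝ} (hθ : ConvexOn ℝ (Icc 0 1) θ) {X : Herm d}
    (hX : X ∈ densityMatrices d) (b : OrthonormalBasis (Fin d) ℂ (EuclideanSpace ℂ (Fin d))) :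
    ∑ i, θ (inner ℝ X (rankOne (b i))) ≤ regularizer θ X := by
  calc ∑ i, θ (inner ℝ X (rankOne (b i)))
      ≤ ∑ i, ∑ j, ‖inner ℂ (X.isHermitian.eigenvectorBasis j) (b i)‖ ^ 2 *
          θ (X.isHermitian.eigenvalues j) := by
        refine Finset.sum_le_sum fun i _ => ?_
        rw [inner_rankOne_eq_sum]
        exact hθ.map_sum_le (fun j _ => by positivity)
          (by rw [X.isHermitian.eigenvectorBasis.sum_sq_norm_inner_right, b.norm_eq_one, one_pow])
          (fun j _ => eigenvalues_mem_Icc hX j)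
    _ = ∑ j, θ (X.isHermitian.eigenvalues j) := by
        rw [Finset.sum_comm]
        refine Finset.sum_congr rfl fun j _ => ?_
        rw [← Finset.sum_mul, b.sum_sq_norm_inner_left,
          X.isHermitian.eigenvectorBasis.norm_eq_one, one_pow, one_mul]
    _ = regularizer θ X := (regularizer_eq_sum θ X).symm

theorem convexOn_regularizer {θ : ℝ → ℝ} (hθ : ConvexOn ℝ (Icc 0 1) θ) :
    ConvexOn ℝ (densityMatrices d) (regularizer θ) := by
  refine ⟨convex_densityMatrices d, fun X hX Y hY s t hs ht hst => ?_⟩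
  set M : Herm d := s • X + t • Y
  set b := M.isHermitian.eigenvectorBasis
  calc regularizer θ M
      = ∑ i, θ (s * inner ℝ X (rankOne (b i)) + t * inner ℝ Y (rankOne (b i))) := by
        rw [regularizer_eq_sum_inner]
        refine Finset.sum_congr rfl fun i _ => ?_
        rw [inner_add_left, real_inner_smul_left, real_inner_smul_left]
    _ ≤ ∑ i, (s * θ (inner ℝ X (rankOne (b i))) + t * θ (inner ℝ Y (rankOne (b i)))) :=
        Finset.sum_le_sum fun i _ => hθ.2 (inner_rankOne_mem_Icc hX (b.norm_eq_one i))
          (inner_rankOne_mem_Icc hY (b.norm_eq_one i)) hs ht hst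
    _ ≤ s • regularizer θ X + t • regularizer θ Y := by
        rw [Finset.sum_add_distrib, ← Finset.mul_sum, ← Finset.mul_sum]
        exact add_le_add (mul_le_mul_of_nonneg_left (sum_le_regularizer hθ hX b) hs)
          (mul_le_mul_of_nonneg_left (sum_le_regularizer hθ hY b) ht)

theorem strongConvexOn_regularizer {θ : ℝ → ℝ} {m : ℝ} (hθ : StrongConvexOn (Icc 0 1) m θ) :
    StrongConvexOn (densityMatrices d) m (regularizer θ) := by
  rw [strongConvexOn_iff_convex] at hθ ⊢
  convert convexOn_regularizer (d := d) hθ using 1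
  funext X
  simp only [regularizer_eq_sum, norm_sq_eq_sum, Finset.sum_sub_distrib, ← Finset.mul_sum,
    Real.norm_eq_abs, sq_abs]

theorem lowerSemicontinuousOn_regularizer {θ : ℝ → ℝ} (hθ : ConvexOn ℝ (Icc 0 1) θ)
    (hc : ContinuousOn θ (Icc 0 1)) :
    LowerSemicontinuousOn (regularizer θ) (densityMatrices d) := by
  intro X hX a ha
  set b := X.isHermitian.eigenvectorBasis
  have hcont : ContinuousOn (fun Y : Herm d => ∑ i, θ (inner ℝ Y (rankOne (b i))))
      (densityMatrices d) :=
    continuousOn_finsetSum _ fun i _ => hc.comp (by fun_prop)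
      (fun Y hY => inner_rankOne_mem_Icc hY (b.norm_eq_one i))
  rw [regularizer_eq_sum_inner] at ha
  filter_upwards [(hcont X hX).eventually (lt_mem_nhds ha), self_mem_nhdsWithin] with Y hY hYD
  exact lt_of_lt_of_le hY (sum_le_regularizer hθ hYD b)

theorem exists_regularizer_le {θ : ℝ → ℝ} (hc : ContinuousOn θ (Icc 0 1)) :
    ∃ M, ∀ X ∈ densityMatrices d, regularizer θ X ≤ M := by
  obtain ⟨M, hM⟩ := isCompact_Icc.bddAbove_image hc
  refine ⟨∑ _j : Fin d, M, fun X hX => ?_⟩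
  rw [regularizer_eq_sum]
  exact Finset.sum_le_sum fun j _ => hM (mem_image_of_mem θ (eigenvalues_mem_Icc hX j))

theorem IsRegularizerKernel.exists_strongConvexOn {θ : ℝ → ℝ} (hθ : IsRegularizerKernel θ) :
    ∃ m > 0, StrongConvexOn (Icc 0 1) m θ := by
  obtain ⟨hc, -, θ', θ'', h1, h2, c, hc0, hc2⟩ := hθ
  refine ⟨c, hc0, strongConvexOn_iff_convex.2 ?_⟩
  simp only [Real.norm_eq_abs, sq_abs]
  have hsub : interior (Icc (0 : ℝ) 1) ⊆ Ioc 0 1 := by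
    rw [interior_Icc]; exact Ioo_subset_Ioc_self
  refine convexOn_of_hasDerivWithinAt2_nonneg (convex_Icc 0 1) (f' := fun x => θ' x - c * x)
    (f'' := fun x => θ'' x - c) (hc.sub (by fun_prop)) (fun x hx => ?_) (fun x hx => ?_)
    (fun x hx => sub_nonneg.2 (hc2 x (hsub hx)))
  · refine ((h1 x (hsub hx)).mono hsub).sub ?_
    have := ((hasDerivAt_pow 2 x).const_mul (c / 2)).hasDerivWithinAt (s := interior (Icc 0 1))
    refine this.congr_deriv ?_
    norm_num
    ring
  · refine ((h2 x (hsub hx)).mono hsub).sub ?_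
    simpa using ((hasDerivAt_id x).const_mul c).hasDerivWithinAt (s := interior (Icc 0 1))

end Density

/-! ### Mirror maps of strongly convex regularizers -/

section Mirror

variable {H : Type*} [NormedAddCommGroup H] [InnerProductSpace ℝ H]

/-- `x` is the regularized best response to the score `y` in `D`: it maximizes
`⟪y, x'⟫ - h x'` over `x' ∈ D`. -/
def IsMirrorPoint (D : Set H) (h : H → ℝ) (y x : H) : Prop :=
  x ∈ D ∧ ∀ x' ∈ D, inner ℝ y x' - h x' ≤ inner ℝ y x - h x

variable {D : Set H} {h : H → ℝ} {m : ℝ} {Q : H → H}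

theorem exists_isMirrorPoint (hD : IsCompact D) (hne : D.Nonempty)
    (hh : LowerSemicontinuousOn h D) (y : H) : ∃ x, IsMirrorPoint D h y x := by
  have hlsc : LowerSemicontinuousOn (fun x => h x + -inner ℝ y x) D :=
    hh.add (Continuous.continuousOn (by fun_prop)).lowerSemicontinuousOn
  obtain ⟨x, hx, hmin⟩ := hlsc.exists_isMinOn hne hD
  refine ⟨x, hx, fun x' hx' => ?_⟩
  have := isMinOn_iff.1 hmin x' hx'
  linarith

theorem IsMirrorPoint.add_sq_le (hh : StrongConvexOn D m h) {x y x' : H}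
    (hx : IsMirrorPoint D h y x) (hx' : x' ∈ D) :
    inner ℝ y x' - h x' + m / 2 * ‖x - x'‖ ^ 2 ≤ inner ℝ y x - h x := by
  -- Optimality against `(1 - s) x + s x'` gives the claim up to a factor `1 - s`; let `s → 0`.
  have key : ∀ s ∈ Ioo (0 : ℝ) 1,
      inner ℝ y x' - h x' + (1 - s) * (m / 2 * ‖x - x'‖ ^ 2) ≤ inner ℝ y x - h x := by
    intro s hs
    have h1 := hh.2 hx.1 hx' (sub_nonneg.2 hs.2.le) hs.1.le (sub_add_cancel 1 s)
    have h2 := hx.2 _ (hh.1 hx.1 hx' (sub_nonneg.2 hs.2.le) hs.1.le (sub_add_cancel 1 s))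
    rw [inner_add_right, real_inner_smul_right, real_inner_smul_right] at h2
    simp only [smul_eq_mul] at h1
    refine le_of_mul_le_mul_left ?_ hs.1
    nlinarith
  have hlim : Tendsto (fun s : ℝ => inner ℝ y x' - h x' + (1 - s) * (m / 2 * ‖x - x'‖ ^ 2))
      (𝓝[>] 0) (𝓝 (inner ℝ y x' - h x' + (1 - 0) * (m / 2 * ‖x - x'‖ ^ 2))) :=
    (Continuous.tendsto (by fun_prop) 0).mono_left nhdsWithin_le_nhds
  rw [sub_zero, one_mul] at hlim
  refine le_of_tendsto hlim ?_
  filter_upwards [Ioo_mem_nhdsGT zero_lt_one] with s hs using key s hs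

/-- Strong convexity makes the mirror map Lipschitz; in particular mirror points are unique. -/
theorem IsMirrorPoint.mul_norm_sub_le (hh : StrongConvexOn D m h) {x y x' y' : H}
    (hx : IsMirrorPoint D h y x) (hx' : IsMirrorPoint D h y' x') :
    m * ‖x - x'‖ ≤ ‖y - y'‖ := by
  have h1 := hx.add_sq_le hh hx'.1
  have h2 := hx'.add_sq_le hh hx.1
  rw [norm_sub_rev x' x] at h2
  have h3 := real_inner_le_norm (y - y') (x - x')
  simp only [inner_sub_left, inner_sub_right] at h3
  rcases (norm_nonneg (x - x')).eq_or_lt with h0 | h0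
  · rw [← h0, mul_zero]; exact norm_nonneg _
  · refine le_of_mul_le_mul_right ?_ h0
    nlinarith

theorem IsMirrorPoint.eq (hm : 0 < m) (hh : StrongConvexOn D m h) {x y x' : H}
    (hx : IsMirrorPoint D h y x) (hx' : IsMirrorPoint D h y x') : x = x' := by
  have := hx.mul_norm_sub_le hh hx'
  rw [sub_self, norm_zero] at this
  have h0 : ‖x - x'‖ ≤ 0 := nonpos_of_mul_nonpos_right this hm
  exact sub_eq_zero.1 (norm_le_zero_iff.1 h0)

theorem lipschitzWith_mirrorMap (hm : 0 < m) (hh : StrongConvexOn D m h)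
    (hQ : ∀ y, IsMirrorPoint D h y (Q y)) : LipschitzWith (m⁻¹).toNNReal Q := by
  refine LipschitzWith.of_dist_le_mul fun y y' => ?_
  rw [Real.coe_toNNReal _ (inv_nonneg.2 hm.le), dist_eq_norm, dist_eq_norm, inv_mul_eq_div,
    le_div_iff₀ hm, mul_comm]
  exact (hQ y).mul_norm_sub_le hh (hQ y')

/-- Scores differing by a vector orthogonal to the direction space of `D` have the same mirror
points. -/
theorem IsMirrorPoint.of_sub_mem_orthogonal {T : Submodule ℝ H}
    (hT : ∀ x ∈ D, ∀ x' ∈ D, x - x' ∈ T) {x y y' : H} (hyy' : y - y' ∈ Tᗮ)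
    (hx : IsMirrorPoint D h y x) : IsMirrorPoint D h y' x := by
  refine ⟨hx.1, fun x' hx' => ?_⟩
  have h1 := hx.2 x' hx'
  have h2 := Submodule.inner_left_of_mem_orthogonal (hT x hx.1 x' hx') hyy'
  simp only [inner_sub_left, inner_sub_right] at h2
  linarith

/-- The Fenchel coupling `h*(y) - ⟪y, e⟫` of a score `y` with the base point `e` (up to the constant
`h e`), where the conjugate `h*(y) = ⟪y, Q y⟫ - h (Q y)` is expressed by the mirror map `Q`. -/
def fenchelCoupling (h : H → ℝ) (Q : H → H) (e y : H) : ℝ :=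
  inner ℝ y (Q y) - h (Q y) - inner ℝ y e

/-- The gradient of the convex conjugate of `h` is the mirror map. -/
theorem hasFDerivAt_fenchelCoupling (hm : 0 < m) (hh : StrongConvexOn D m h)
    (hQ : ∀ y, IsMirrorPoint D h y (Q y)) (e y : H) :
    HasFDerivAt (fenchelCoupling h Q e) (innerSL ℝ (Q y - e)) y := by
  rw [hasFDerivAt_iff_isLittleO]
  refine Asymptotics.IsBigO.trans_isLittleO (g := fun y' : H => ‖y' - y‖ ^ 2) ?_ ?_
  · refine Asymptotics.IsBigO.of_bound m⁻¹ (Eventually.of_forall fun y' => ?_)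
    have h1 := (hQ y').2 (Q y) (hQ y).1
    have h2 := (hQ y).2 (Q y') (hQ y').1
    have h3 := real_inner_le_norm (y' - y) (Q y' - Q y)
    have h4 := (lipschitzWith_mirrorMap hm hh hQ).norm_sub_le y' y
    rw [Real.coe_toNNReal _ (inv_nonneg.2 hm.le)] at h4
    have h5 := mul_le_mul_of_nonneg_left h4 (norm_nonneg (y' - y))
    have hexp : fenchelCoupling h Q e y' - fenchelCoupling h Q e y - innerSL ℝ (Q y - e) (y' - y)
        = inner ℝ y' (Q y') - h (Q y') - (inner ℝ y' (Q y) - h (Q y)) := by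
      simp only [fenchelCoupling, innerSL_apply_apply, inner_sub_left, inner_sub_right,
        real_inner_comm y (Q y), real_inner_comm y' (Q y), real_inner_comm y e,
        real_inner_comm y' e]
      ring
    rw [hexp, Real.norm_of_nonneg (by linarith), Real.norm_of_nonneg (by positivity)]
    simp only [inner_sub_left, inner_sub_right] at h3
    nlinarith
  · exact Asymptotics.isLittleO_pow_sub_sub y one_lt_two

theorem continuous_fenchelCoupling (hm : 0 < m) (hh : StrongConvexOn D m h)
    (hQ : ∀ y, IsMirrorPoint D h y (Q y)) (e : H) : Continuous (fenchelCoupling h Q e) :=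
  continuous_iff_continuousAt.2 fun y => (hasFDerivAt_fenchelCoupling hm hh hQ e y).continuousAt

/-- The Fenchel coupling grows linearly along directions in which a ball around the base point
stays in `D`. -/
theorem mul_norm_le_fenchelCoupling (hQ : ∀ y, IsMirrorPoint D h y (Q y)) {M ε : ℝ}
    (hM : ∀ x ∈ D, h x ≤ M) {e : H} {T : Submodule ℝ H} (hε : 0 < ε)
    (he : ∀ z ∈ T, ‖z‖ ≤ ε → e + z ∈ D) {z : H} (hz : z ∈ T) :
    ε * ‖z‖ - M ≤ fenchelCoupling h Q e z := by
  -- Compare with the competitor `e + ε z / ‖z‖`; for `z = 0` this is `e` itself.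
  set w : H := (ε / ‖z‖) • z
  have hw : ‖w‖ ≤ ε := by
    rw [norm_smul, norm_div, norm_norm, Real.norm_of_nonneg hε.le]
    rcases eq_or_ne ‖z‖ 0 with h0 | h0
    · simp [h0, hε.le]
    · rw [div_mul_cancel₀ _ h0]
  have hmem := he w (T.smul_mem _ hz) hw
  have h1 := (hQ z).2 _ hmem
  have h2 := hM _ hmem
  have h3 : inner ℝ z w = ε * ‖z‖ := by
    rw [real_inner_smul_right, real_inner_self_eq_norm_sq]
    rcases eq_or_ne ‖z‖ 0 with h0 | h0
    · simp [h0]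
    · field_simp
  rw [inner_add_right, h3] at h1
  unfold fenchelCoupling
  linarith

end Mirror

/-! ### Null sets of Haar measures -/

section Haar

/-- Lipschitz self-maps of a finite-dimensional space preserve Lebesgue null sets, because Lebesgue
measure is equivalent to the Hausdorff measure of the same dimension. -/
theorem addHaar_image_eq_zero_of_lipschitzWith {E : Type*} [NormedAddCommGroup E]
    [NormedSpace ℝ E] [FiniteDimensional ℝ E] [MeasurableSpace E] [BorelSpace E]
    (μ : Measure E) [μ.IsAddHaarMeasure] {K : ℝ≥0} {f : E → E} (hf : LipschitzWith K f)
    {s : Set E} (hs : μ s = 0) : μ (f '' s) = 0 := by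
  have := FiniteDimensional.proper_real E
  have h1 : μH[Module.finrank ℝ E] s = 0 :=
    Measure.absolutelyContinuous_isAddHaarMeasure _ μ hs
  refine Measure.absolutelyContinuous_isAddHaarMeasure μ μH[Module.finrank ℝ E] ?_
  refine le_antisymm ((hf.hausdorffMeasure_image_le (Nat.cast_nonneg _) s).trans ?_) zero_le
  rw [h1, mul_zero]

/-- The almost-everywhere form of `addHaar_image_eq_zero_of_lipschitzWith`. -/
theorem ae_forall_eq_of_lipschitzWith {E : Type*} [NormedAddCommGroup E]
    [NormedSpace ℝ E] [FiniteDimensional ℝ E] [MeasurableSpace E] [BorelSpace E]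
    (μ : Measure E) [μ.IsAddHaarMeasure] {K : ℝ≥0} {f : E → E} (hf : LipschitzWith K f)
    {p : E → Prop} (hp : ∀ᵐ z ∂μ, p z) : ∀ᵐ w ∂μ, ∀ z, f z = w → p z := by
  have h0 := addHaar_image_eq_zero_of_lipschitzWith μ hf (ae_iff.1 hp)
  filter_upwards [measure_eq_zero_iff_ae_notMem.1 h0] with w hw z hz
  by_contra hpz
  exact hw ⟨z, hpz, hz⟩

theorem ae_comp_linearMap_of_surjective {E F : Type*} [NormedAddCommGroup E] [NormedSpace ℝ E]
    [FiniteDimensional ℝ E] [MeasurableSpace E] [BorelSpace E] [NormedAddCommGroup F]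
    [NormedSpace ℝ F] [MeasurableSpace F] [BorelSpace F]
    (μ : Measure E) (ν : Measure F) [μ.IsAddHaarMeasure] [ν.IsAddHaarMeasure] {A : E →ₗ[ℝ] F}
    (hA : Function.Surjective A) {p : F → Prop} (hp : ∀ᵐ y ∂ν, p y) : ∀ᵐ x ∂μ, p (A x) := by
  have := FiniteDimensional.proper_real E
  obtain ⟨s, hs, hsm, hs0⟩ := exists_measurable_superset_of_null (ae_iff.1 hp)
  have h := (ae_comp_linearMap_mem_iff A μ ν hA hsm.compl).2 (measure_eq_zero_iff_ae_notMem.1 hs0)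
  filter_upwards [h] with x hx
  by_contra hpx
  exact hx (hs hpx)

end Haar

/-! ### Recurrence of zero-sum mirror dynamics -/

/-- The data of one player: a compact set `D` of strategies whose differences lie in the subspace
`T`, a strongly convex regularizer `h`, bounded above on `D`, with mirror map `Q`, and a base point
`e` of `D` that is interior relative to `e + T`. -/
structure IsMirrorSystem {H : Type*} [NormedAddCommGroup H] [InnerProductSpace ℝ H]
    (D : Set H) (h : H → ℝ) (m : ℝ) (Q : H → H) (T : Submodule ℝ H) (e : H) : Prop where
  isCompact : IsCompact D
  pos : 0 < m
  strongConvexOn : StrongConvexOn D m h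
  mirror : ∀ y, IsMirrorPoint D h y (Q y)
  bound : ∃ M, ∀ x ∈ D, h x ≤ M
  sub_mem : ∀ x ∈ D, ∀ x' ∈ D, x - x' ∈ T
  base_mem : e ∈ D
  interior : ∃ ε > 0, ∀ z ∈ T, ‖z‖ ≤ ε → e + z ∈ D

namespace IsMirrorSystem

variable {H : Type*} [NormedAddCommGroup H] [InnerProductSpace ℝ H]
  {D : Set H} {h : H → ℝ} {m : ℝ} {Q : H → H} {T : Submodule ℝ H} {e : H}

theorem apply_starProjection [T.HasOrthogonalProjection] (S : IsMirrorSystem D h m Q T e)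
    (y : H) : Q (T.starProjection y) = Q y := by
  have h1 : IsMirrorPoint D h (T.starProjection y) (Q y) :=
    (S.mirror y).of_sub_mem_orthogonal S.sub_mem (T.sub_starProjection_mem_orthogonal y)
  exact (S.mirror _).eq S.pos S.strongConvexOn h1

theorem exists_lipschitzWith_comp {G : Type*} [NormedAddCommGroup G] [NormedSpace ℝ G]
    (S : IsMirrorSystem D h m Q T e) (A : H →L[ℝ] G) :
    ∃ K, LipschitzWith K (fun y => A (Q y)) :=
  ⟨_, A.lipschitz.comp (lipschitzWith_mirrorMap S.pos S.strongConvexOn S.mirror)⟩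

theorem exists_norm_comp_le {G : Type*} [NormedAddCommGroup G] [NormedSpace ℝ G]
    (S : IsMirrorSystem D h m Q T e) (A : H →L[ℝ] G) : ∃ L : ℝ≥0, ∀ y, ‖A (Q y)‖ ≤ L := by
  obtain ⟨L, hL⟩ := (S.isCompact.image A.continuous).isBounded.exists_norm_le
  exact ⟨L.toNNReal, fun y =>
    (hL _ (mem_image_of_mem A (S.mirror y).1)).trans (Real.le_coe_toNNReal L)⟩

/-- By first-order optimality, a payoff vector for which the interior base point is a best response
is orthogonal to the direction space. -/
theorem inner_eq_zero (S : IsMirrorSystem D h m Q T e) {v : H}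
    (hv : ∀ x ∈ D, inner ℝ x v ≤ inner ℝ e v) {z : H} (hz : z ∈ T) : inner ℝ z v = 0 := by
  obtain ⟨ε, hε, he⟩ := S.interior
  have key : ∀ w ∈ T, inner ℝ w v ≤ 0 := by
    intro w hw
    have hpos : 0 < ε / (‖w‖ + 1) := by positivity
    have hnorm : ‖(ε / (‖w‖ + 1)) • w‖ ≤ ε := by
      rw [norm_smul, Real.norm_of_nonneg hpos.le, div_mul_eq_mul_div, div_le_iff₀ (by positivity)]
      nlinarith [norm_nonneg w]
    have h1 := hv _ (he _ (T.smul_mem _ hw) hnorm)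
    rw [inner_add_left, real_inner_smul_left] at h1
    exact nonpos_of_mul_nonpos_right (by linarith) hpos
  have h1 := key z hz
  have h2 := key (-z) (T.neg_mem hz)
  rw [inner_neg_left] at h2
  linarith

theorem exists_le_fenchelCoupling (S : IsMirrorSystem D h m Q T e) :
    ∃ ε > 0, ∃ M, ∀ z ∈ T, ε * ‖z‖ - M ≤ fenchelCoupling h Q e z := by
  obtain ⟨ε, hε, he⟩ := S.interior
  obtain ⟨M, hM⟩ := S.bound
  exact ⟨ε, hε, M, fun z hz => mul_norm_le_fenchelCoupling S.mirror hM hε he hz⟩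

end IsMirrorSystem

section ZeroSum

variable {H₁ H₂ : Type*} [NormedAddCommGroup H₁] [InnerProductSpace ℝ H₁]
  [NormedAddCommGroup H₂] [InnerProductSpace ℝ H₂]
  {D₁ : Set H₁} {h₁ : H₁ → ℝ} {m₁ : ℝ} {Q₁ : H₁ → H₁} {T₁ : Submodule ℝ H₁} {e₁ : H₁}
  {D₂ : Set H₂} {h₂ : H₂ → ℝ} {m₂ : ℝ} {Q₂ : H₂ → H₂} {T₂ : Submodule ℝ H₂} {e₂ : H₂}
  {V₁ : H₂ →L[ℝ] H₁} {V₂ : H₁ →L[ℝ] H₂}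

theorem exists_isForwardTrajectory_mirror [CompleteSpace H₁] [CompleteSpace H₂]
    (S₁ : IsMirrorSystem D₁ h₁ m₁ Q₁ T₁ e₁) (S₂ : IsMirrorSystem D₂ h₂ m₂ Q₂ T₂ e₂)
    (V₁ : H₂ →L[ℝ] H₁) (V₂ : H₁ →L[ℝ] H₂) (Y₀ : H₁ × H₂) :
    ∃ Y, IsForwardTrajectory (separableField (fun y => V₁ (Q₂ y)) (fun y => V₂ (Q₁ y))) Y ∧
      Y 0 = Y₀ := by
  obtain ⟨K₁, hK₁⟩ := S₂.exists_lipschitzWith_comp V₁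
  obtain ⟨K₂, hK₂⟩ := S₁.exists_lipschitzWith_comp V₂
  obtain ⟨L₁, hL₁⟩ := S₂.exists_norm_comp_le V₁
  obtain ⟨L₂, hL₂⟩ := S₁.exists_norm_comp_le V₂
  exact exists_isForwardTrajectory (K := max K₁ K₂) (L := max L₁ L₂)
    (lipschitzWith_separableField (hK₁.weaken (le_max_left _ _)) (hK₂.weaken (le_max_right _ _)))
    (norm_separableField_le (fun y => (hL₁ y).trans (by exact_mod_cast le_max_left _ _))
      (fun y => (hL₂ y).trans (by exact_mod_cast le_max_right _ _))) Y₀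

variable [T₁.HasOrthogonalProjection] [T₂.HasOrthogonalProjection]

/-- Along the reduced dynamics on `T₁ × T₂` the total Fenchel coupling with an interior equilibrium
`(e₁, e₂)` of a zero-sum game is constant. -/
theorem fenchelCoupling_add_eq (S₁ : IsMirrorSystem D₁ h₁ m₁ Q₁ T₁ e₁)
    (S₂ : IsMirrorSystem D₂ h₂ m₂ Q₂ T₂ e₂)
    (hzero : ∀ x₁ ∈ D₁, ∀ x₂ ∈ D₂, inner ℝ x₁ (V₁ x₂) = -inner ℝ x₂ (V₂ x₁))
    (hE₁ : ∀ x ∈ D₁, inner ℝ x (V₁ e₂) ≤ inner ℝ e₁ (V₁ e₂))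
    (hE₂ : ∀ x ∈ D₂, inner ℝ x (V₂ e₁) ≤ inner ℝ e₂ (V₂ e₁))
    {Z : ℝ → T₁ × T₂} (hZ : IsForwardTrajectory (separableField
      (fun z : T₂ => T₁.orthogonalProjectionOnto (V₁ (Q₂ z)))
      (fun z : T₁ => T₂.orthogonalProjectionOnto (V₂ (Q₁ z)))) Z) {t : ℝ} (ht : 0 ≤ t) :
    fenchelCoupling h₁ Q₁ e₁ (Z t).1 + fenchelCoupling h₂ Q₂ e₂ (Z t).2 =
      fenchelCoupling h₁ Q₁ e₁ (Z 0).1 + fenchelCoupling h₂ Q₂ e₂ (Z 0).2 := by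
  have hderiv : ∀ s, 0 ≤ s → HasDerivWithinAt (fun s => fenchelCoupling h₁ Q₁ e₁ (Z s).1 +
      fenchelCoupling h₂ Q₂ e₂ (Z s).2) 0 (Ici 0) s := by
    intro s hs
    set x₁ := Q₁ (Z s).1
    set x₂ := Q₂ (Z s).2
    have hx₁ : x₁ ∈ D₁ := (S₁.mirror _).1
    have hx₂ : x₂ ∈ D₂ := (S₂.mirror _).1
    have hZ₁ : HasDerivWithinAt (fun s => ((Z s).1 : H₁))
        (T₁.orthogonalProjectionOnto (V₁ x₂) : H₁) (Ici 0) s :=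
      (T₁.subtypeL.comp (ContinuousLinearMap.fst ℝ T₁ T₂)).hasFDerivAt.comp_hasDerivWithinAt s
        (hZ s hs)
    have hZ₂ : HasDerivWithinAt (fun s => ((Z s).2 : H₂))
        (T₂.orthogonalProjectionOnto (V₂ x₁) : H₂) (Ici 0) s :=
      (T₂.subtypeL.comp (ContinuousLinearMap.snd ℝ T₁ T₂)).hasFDerivAt.comp_hasDerivWithinAt s
        (hZ s hs)
    have hΦ₁ := (hasFDerivAt_fenchelCoupling S₁.pos S₁.strongConvexOn S₁.mirror e₁
      ((Z s).1 : H₁)).comp_hasDerivWithinAt s hZ₁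
    have hΦ₂ := (hasFDerivAt_fenchelCoupling S₂.pos S₂.strongConvexOn S₂.mirror e₂
      ((Z s).2 : H₂)).comp_hasDerivWithinAt s hZ₂
    refine (hΦ₁.add hΦ₂).congr_deriv ?_
    have hp₁ : inner ℝ (x₁ - e₁) (T₁.orthogonalProjectionOnto (V₁ x₂) : H₁) =
        inner ℝ (x₁ - e₁) (V₁ x₂) :=
      T₁.inner_orthogonalProjectionOnto_eq_of_mem_left
        ⟨x₁ - e₁, S₁.sub_mem _ hx₁ _ S₁.base_mem⟩ (V₁ x₂)
    have hp₂ : inner ℝ (x₂ - e₂) (T₂.orthogonalProjectionOnto (V₂ x₁) : H₂) =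
        inner ℝ (x₂ - e₂) (V₂ x₁) :=
      T₂.inner_orthogonalProjectionOnto_eq_of_mem_left
        ⟨x₂ - e₂, S₂.sub_mem _ hx₂ _ S₂.base_mem⟩ (V₂ x₁)
    have o₁ := S₁.inner_eq_zero hE₁ (S₁.sub_mem _ hx₁ _ S₁.base_mem)
    have o₂ := S₂.inner_eq_zero hE₂ (S₂.sub_mem _ hx₂ _ S₂.base_mem)
    rw [innerSL_apply_apply, innerSL_apply_apply, hp₁, hp₂]
    rw [inner_sub_left] at o₁ o₂ ⊢
    rw [inner_sub_left]
    linarith [hzero x₁ hx₁ x₂ hx₂, hzero e₁ S₁.base_mem x₂ hx₂, hzero x₁ hx₁ e₂ S₂.base_mem,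
      hzero e₁ S₁.base_mem e₂ S₂.base_mem]
  exact constant_of_has_deriv_right_zero
    (fun s hs => (hderiv s hs.1).continuousWithinAt.mono Icc_subset_Ici_self)
    (fun s hs => (hderiv s hs.1).mono (Ici_subset_Ici.2 hs.1)) t ⟨ht, le_rfl⟩

/-- Zero-sum mirror dynamics with an interior equilibrium is recurrent for almost every projection
of the initial score to the direction spaces. -/
theorem ae_exists_recurrent_mirror [FiniteDimensional ℝ T₁] [FiniteDimensional ℝ T₂]
    [MeasurableSpace T₁] [BorelSpace T₁] [MeasurableSpace T₂] [BorelSpace T₂]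
    (μ₁ : Measure T₁) (μ₂ : Measure T₂) [μ₁.IsAddHaarMeasure] [μ₂.IsAddHaarMeasure]
    (S₁ : IsMirrorSystem D₁ h₁ m₁ Q₁ T₁ e₁)
    (S₂ : IsMirrorSystem D₂ h₂ m₂ Q₂ T₂ e₂)
    (hzero : ∀ x₁ ∈ D₁, ∀ x₂ ∈ D₂, inner ℝ x₁ (V₁ x₂) = -inner ℝ x₂ (V₂ x₁))
    (hE₁ : ∀ x ∈ D₁, inner ℝ x (V₁ e₂) ≤ inner ℝ e₁ (V₁ e₂))
    (hE₂ : ∀ x ∈ D₂, inner ℝ x (V₂ e₁) ≤ inner ℝ e₂ (V₂ e₁)) :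
    ∀ᵐ z ∂(μ₁.prod μ₂), ∀ Y,
      IsForwardTrajectory (separableField (fun y => V₁ (Q₂ y)) (fun y => V₂ (Q₁ y))) Y →
      (T₁.orthogonalProjectionOnto (Y 0).1, T₂.orthogonalProjectionOnto (Y 0).2) = z →
      ∃ τ : ℕ → ℕ, StrictMono τ ∧ Tendsto (fun n => (Q₁ (Y (τ n)).1, Q₂ (Y (τ n)).2)) atTop
        (𝓝 (Q₁ (Y 0).1, Q₂ (Y 0).2)) := by
  obtain ⟨K₁, hK₁⟩ := S₂.exists_lipschitzWith_comp (T₁.orthogonalProjectionOnto.comp V₁)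
  obtain ⟨K₂, hK₂⟩ := S₁.exists_lipschitzWith_comp (T₂.orthogonalProjectionOnto.comp V₂)
  obtain ⟨L₁, hL₁⟩ := S₂.exists_norm_comp_le (T₁.orthogonalProjectionOnto.comp V₁)
  obtain ⟨L₂, hL₂⟩ := S₁.exists_norm_comp_le (T₂.orthogonalProjectionOnto.comp V₂)
  obtain ⟨ε₁, hε₁, M₁, hM₁⟩ := S₁.exists_le_fenchelCoupling
  obtain ⟨ε₂, hε₂, M₂, hM₂⟩ := S₂.exists_le_fenchelCoupling
  have hQ₁ : Continuous Q₁ :=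
    (lipschitzWith_mirrorMap S₁.pos S₁.strongConvexOn S₁.mirror).continuous
  have hQ₂ : Continuous Q₂ :=
    (lipschitzWith_mirrorMap S₂.pos S₂.strongConvexOn S₂.mirror).continuous
  have hf : LipschitzWith (max K₁ K₂)
      (fun z : T₂ => T₁.orthogonalProjectionOnto (V₁ (Q₂ z))) := by
    have := (hK₁.weaken (le_max_left K₁ K₂)).comp (LipschitzWith.subtype_val (T₂ : Set H₂))
    rwa [mul_one] at this
  have hg : LipschitzWith (max K₁ K₂)
      (fun z : T₁ => T₂.orthogonalProjectionOnto (V₂ (Q₁ z))) := by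
    have := (hK₂.weaken (le_max_right K₁ K₂)).comp (LipschitzWith.subtype_val (T₁ : Set H₁))
    rwa [mul_one] at this
  have hΦ₁ := continuous_fenchelCoupling S₁.pos S₁.strongConvexOn S₁.mirror e₁
  have hΦ₂ := continuous_fenchelCoupling S₂.pos S₂.strongConvexOn S₂.mirror e₂
  have hrec := ae_exists_recurrent μ₁ μ₂ (L := max L₁ L₂) hf hg
    (fun z => (hL₁ z).trans (by exact_mod_cast le_max_left _ _))
    (fun z => (hL₂ z).trans (by exact_mod_cast le_max_right _ _))
    (F := fun z => fenchelCoupling h₁ Q₁ e₁ z.1 + fenchelCoupling h₂ Q₂ e₂ z.2)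
    (by fun_prop) ?_
    (fun Z hZ t ht => fenchelCoupling_add_eq S₁ S₂ hzero hE₁ hE₂ hZ ht)
  · filter_upwards [hrec] with z hz Y hY hYz
    set P : H₁ × H₂ →L[ℝ] T₁ × T₂ :=
      T₁.orthogonalProjectionOnto.prodMap T₂.orthogonalProjectionOnto
    have hPY : IsForwardTrajectory (separableField
        (fun z : T₂ => T₁.orthogonalProjectionOnto (V₁ (Q₂ z)))
        (fun z : T₁ => T₂.orthogonalProjectionOnto (V₂ (Q₁ z)))) (fun t => P (Y t)) := by
      intro t ht
      refine (P.hasFDerivAt.comp_hasDerivWithinAt t (hY t ht)).congr_deriv ?_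
      simp [P, separableField, S₁.apply_starProjection, S₂.apply_starProjection]
    obtain ⟨τ, hτ, hlim⟩ := hz _ hPY hYz
    refine ⟨τ, hτ, ?_⟩
    have hcont : Continuous fun z : T₁ × T₂ => (Q₁ z.1, Q₂ z.2) := by fun_prop
    have := (hcont.tendsto (P (Y 0))).comp hlim
    simpa [P, Function.comp_def, S₁.apply_starProjection, S₂.apply_starProjection]
      using this
  · intro c
    refine isBounded_iff_forall_norm_le.2
      ⟨max ((c + M₁ + M₂) / ε₁) ((c + M₁ + M₂) / ε₂), fun z hz => ?_⟩
    have hz' : fenchelCoupling h₁ Q₁ e₁ z.1 + fenchelCoupling h₂ Q₂ e₂ z.2 < c := hz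
    have b₁ := hM₁ z.1 z.1.2
    have b₂ := hM₂ z.2 z.2.2
    have n₁ : 0 ≤ ε₁ * ‖(z.1 : H₁)‖ := by positivity
    have n₂ : 0 ≤ ε₂ * ‖(z.2 : H₂)‖ := by positivity
    refine max_le_max ?_ ?_
    · rw [le_div_iff₀ hε₁, mul_comm]
      change ε₁ * ‖(z.1 : H₁)‖ ≤ _
      linarith
    · rw [le_div_iff₀ hε₂, mul_comm]
      change ε₂ * ‖(z.2 : H₂)‖ ≤ _
      linarith

end ZeroSum

/-! ### Application to quantum games -/

section Application

variable {d d₁ d₂ : ℕ} {Ω : Type*} [Fintype Ω]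

theorem exists_isMirrorSystem {θ : ℝ → ℝ} (hθ : IsRegularizerKernel θ) {E : Herm d}
    (hE : E ∈ densityMatrices d) (hrank : E.mat.rank = d) :
    ∃ m Q, IsMirrorSystem (densityMatrices d) (regularizer θ) m Q (tracelessHerm d) E := by
  obtain ⟨m, hm, hsc⟩ := hθ.exists_strongConvexOn
  have hconv : ConvexOn ℝ (Icc 0 1) θ := UniformConvexOn.convexOn hsc fun r => by
    simp only [Pi.zero_apply]; positivity
  choose Q hQ using exists_isMirrorPoint (isCompact_densityMatrices d) ⟨E, hE⟩
    (lowerSemicontinuousOn_regularizer hconv hθ.1)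
  exact ⟨m, Q,
    { isCompact := isCompact_densityMatrices d
      pos := hm
      strongConvexOn := strongConvexOn_regularizer hsc
      mirror := hQ
      bound := exists_regularizer_le hθ.1
      sub_mem := fun X hX X' hX' => by
        have h : Herm.traceLin d (X - X') = 0 := by
          rw [map_sub]
          exact sub_eq_zero.2 (hX.2.trans hX'.2.symm)
        exact h
      base_mem := hE
      interior := exists_add_mem_densityMatrices hE hrank }⟩

theorem Game.gradient₁_mat_apply (G : Game d₁ d₂ Ω) (X : Herm d₂) (a b : Fin d₁) :
    (G.gradient₁ X).mat a b =
      ∑ ω, (G.obs₁ ω : ℂ) * ∑ c, ∑ d, G.povm ω (a, c) (b, d) * X.mat d c := rfl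

theorem Game.gradient₂_mat_apply (G : Game d₁ d₂ Ω) (X : Herm d₁) (c d : Fin d₂) :
    (G.gradient₂ X).mat c d =
      ∑ ω, (G.obs₂ ω : ℂ) * ∑ a, ∑ b, G.povm ω (a, c) (b, d) * X.mat b a := rfl

/-- The payoff gradient of the first player as a continuous linear map. -/
noncomputable def Game.gradientCLM₁ (G : Game d₁ d₂ Ω) : Herm d₂ →L[ℝ] Herm d₁ :=
  LinearMap.toContinuousLinearMap
    { toFun := G.gradient₁
      map_add' := fun X Y => Subtype.ext <| Matrix.ext fun a b => by
        change (G.gradient₁ (X + Y)).mat a b = ((G.gradient₁ X).mat + (G.gradient₁ Y).mat) a b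
        simp only [gradient₁_mat_apply, Matrix.add_apply, Herm.mat_add, mul_add,
          Finset.sum_add_distrib]
      map_smul' := fun r X => Subtype.ext <| Matrix.ext fun a b => by
        change (G.gradient₁ (r • X)).mat a b = (r • (G.gradient₁ X).mat) a b
        simp only [gradient₁_mat_apply, Matrix.smul_apply, Herm.mat_smul, Complex.real_smul,
          Finset.mul_sum]
        refine Finset.sum_congr rfl fun ω _ => Finset.sum_congr rfl fun c _ =>
          Finset.sum_congr rfl fun d _ => ?_
        ring }

/-- The payoff gradient of the second player as a continuous linear map. -/
noncomputable def Game.gradientCLM₂ (G : Game d₁ d₂ Ω) : Herm d₁ →L[ℝ] Herm d₂ :=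
  LinearMap.toContinuousLinearMap
    { toFun := G.gradient₂
      map_add' := fun X Y => Subtype.ext <| Matrix.ext fun a b => by
        change (G.gradient₂ (X + Y)).mat a b = ((G.gradient₂ X).mat + (G.gradient₂ Y).mat) a b
        simp only [gradient₂_mat_apply, Matrix.add_apply, Herm.mat_add, mul_add,
          Finset.sum_add_distrib]
      map_smul' := fun r X => Subtype.ext <| Matrix.ext fun a b => by
        change (G.gradient₂ (r • X)).mat a b = (r • (G.gradient₂ X).mat) a b
        simp only [gradient₂_mat_apply, Matrix.smul_apply, Herm.mat_smul, Complex.real_smul,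
          Finset.mul_sum]
        refine Finset.sum_congr rfl fun ω _ => Finset.sum_congr rfl fun c _ =>
          Finset.sum_congr rfl fun d _ => ?_
        ring }

theorem sub_maximallyMixed_mem {X : Herm d} (hX : X ∈ densityMatrices d) :
    X - maximallyMixed d ∈ tracelessHerm d := by
  have hd : d ≠ 0 := by
    rintro rfl
    have h := hX.2
    simp [Matrix.trace] at h
  have h1 : (maximallyMixed d).mat.trace = 1 := by
    change ((d : ℝ)⁻¹ • (1 : Matrix (Fin d) (Fin d) ℂ)).trace = 1
    rw [Matrix.trace_smul, Matrix.trace_one, Fintype.card_fin, Complex.real_smul]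
    push_cast
    exact inv_mul_cancel₀ (by exact_mod_cast hd)
  have h : Herm.traceLin d (X - maximallyMixed d) = 0 := by
    rw [map_sub]
    exact sub_eq_zero.2 (hX.2.trans h1.symm)
  exact h

/-- The inclusion of pairs of traceless matrices into pairs of matrices, translated by the maximally
mixed states. -/
noncomputable def stateChart (d₁ d₂ : ℕ) :
    tracelessHerm d₁ × tracelessHerm d₂ → Herm d₁ × Herm d₂ :=
  Prod.map (fun Z => maximallyMixed d₁ + (Z : Herm d₁)) (fun Z => maximallyMixed d₂ + (Z : Herm d₂))

/-- Read in the chart around the maximally mixed state, the mirror map induces a Lipschitz self-map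
of the space of traceless matrices. -/
theorem IsMirrorSystem.exists_lipschitzWith_chart {h : Herm d → ℝ} {m : ℝ} {Q : Herm d → Herm d}
    {E : Herm d} (S : IsMirrorSystem (densityMatrices d) h m Q (tracelessHerm d) E) :
    ∃ q : tracelessHerm d → tracelessHerm d,
      (∀ y, (q ((tracelessHerm d).orthogonalProjectionOnto y) : Herm d) =
        Q y - maximallyMixed d) ∧ ∃ K, LipschitzWith K q := by
  refine ⟨fun z => ⟨Q z - maximallyMixed d, sub_maximallyMixed_mem (S.mirror z).1⟩, fun y => ?_,
    (m⁻¹).toNNReal, LipschitzWith.of_dist_le_mul fun z w => ?_⟩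
  · exact congrArg (· - maximallyMixed d) (S.apply_starProjection y)
  · rw [Subtype.dist_eq, dist_sub_right]
    exact (lipschitzWith_mirrorMap S.pos S.strongConvexOn S.mirror).dist_le_mul z w

theorem measurableEmbedding_add_traceless (d : ℕ) :
    MeasurableEmbedding (fun Z : tracelessHerm d => maximallyMixed d + (Z : Herm d)) :=
  (measurableEmbedding_addLeft (maximallyMixed d)).comp
    (MeasurableEmbedding.subtype_coe (tracelessHerm d).closed_of_finiteDimensional.measurableSet)

theorem ae_stateLebesgue_iff {p : Herm d₁ × Herm d₂ → Prop} :
    (∀ᵐ X ∂(stateLebesgue d₁ d₂), p X) ↔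
      ∀ᵐ Z ∂((Measure.addHaar : Measure (tracelessHerm d₁)).prod
        (Measure.addHaar : Measure (tracelessHerm d₂))), p (stateChart d₁ d₂ Z) := by
  rw [stateLebesgue, traceOneLebesgue, traceOneLebesgue,
    Measure.map_prod_map _ _ (measurableEmbedding_add_traceless d₁).measurable
      (measurableEmbedding_add_traceless d₂).measurable]
  exact ((measurableEmbedding_add_traceless d₁).prodMap
    (measurableEmbedding_add_traceless d₂)).ae_map_iff

end Application

end QuantumGame

open QuantumGame in
theorem mainTheorem2 {d₁ d₂ : ℕ} {Ω : Type*} [Fintype Ω]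
    (G : QuantumGame.Game d₁ d₂ Ω) (hzero : G.IsZeroSum)
    (E₁ : QuantumGame.Herm d₁) (E₂ : QuantumGame.Herm d₂)
    (hE : G.IsNashEquilibrium E₁ E₂)
    (hrank₁ : E₁.mat.rank = d₁)
    (hrank₂ : E₂.mat.rank = d₂)
    (θ₁ θ₂ : ℝ → ℝ)
    (hθ₁ : QuantumGame.IsRegularizerKernel θ₁) (hθ₂ : QuantumGame.IsRegularizerKernel θ₂) :
    (∀ Y₀ : QuantumGame.Herm d₁ × QuantumGame.Herm d₂,
      ∃ Y X : ℝ → QuantumGame.Herm d₁ × QuantumGame.Herm d₂,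
        G.IsFTQLSolution θ₁ θ₂ Y X ∧ Y 0 = Y₀) ∧
    (∀ᵐ Y₀ ∂(QuantumGame.hermLebesgue d₁ d₂),
      ∀ Y X : ℝ → QuantumGame.Herm d₁ × QuantumGame.Herm d₂,
        G.IsFTQLSolution θ₁ θ₂ Y X → Y 0 = Y₀ → QuantumGame.IsPoincareRecurrent X) ∧
    (∀ᵐ X₀ ∂(QuantumGame.stateLebesgue d₁ d₂),
      ∀ Y X : ℝ → QuantumGame.Herm d₁ × QuantumGame.Herm d₂,
        G.IsFTQLSolution θ₁ θ₂ Y X → X 0 = X₀ → QuantumGame.IsPoincareRecurrent X) := by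
  obtain ⟨m₁, Q₁, S₁⟩ := exists_isMirrorSystem hθ₁ hE.1 hrank₁
  obtain ⟨m₂, Q₂, S₂⟩ := exists_isMirrorSystem hθ₂ hE.2.1 hrank₂
  have hzs : ∀ X₁ ∈ densityMatrices d₁, ∀ X₂ ∈ densityMatrices d₂,
      inner ℝ X₁ (G.gradientCLM₁ X₂) = -inner ℝ X₂ (G.gradientCLM₂ X₁) := by
    intro X₁ h₁ X₂ h₂
    have h := hzero X₁ h₁ X₂ h₂
    rwa [G.payoff₁_eq, G.payoff₂_eq] at h
  have hE₁ : ∀ X ∈ densityMatrices d₁,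
      inner ℝ X (G.gradientCLM₁ E₂) ≤ inner ℝ E₁ (G.gradientCLM₁ E₂) := by
    intro X hX
    have h := hE.2.2.1 X hX
    rwa [G.payoff₁_eq, G.payoff₁_eq] at h
  have hE₂ : ∀ X ∈ densityMatrices d₂,
      inner ℝ X (G.gradientCLM₂ E₁) ≤ inner ℝ E₂ (G.gradientCLM₂ E₁) := by
    intro X hX
    have h := hE.2.2.2 X hX
    rwa [G.payoff₂_eq, G.payoff₂_eq] at h
  set μ₁ : Measure (tracelessHerm d₁) := Measure.addHaar
  set μ₂ : Measure (tracelessHerm d₂) := Measure.addHaar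
  have hX : ∀ {Y X}, G.IsFTQLSolution θ₁ θ₂ Y X → ∀ t, 0 ≤ t →
      X t = (Q₁ (Y t).1, Q₂ (Y t).2) := fun hYX t ht => Prod.ext
    (IsMirrorPoint.eq S₁.pos S₁.strongConvexOn (hYX t ht).1 (S₁.mirror _))
    (IsMirrorPoint.eq S₂.pos S₂.strongConvexOn (hYX t ht).2.1 (S₂.mirror _))
  have hrec : ∀ᵐ z ∂(μ₁.prod μ₂), ∀ Y X, G.IsFTQLSolution θ₁ θ₂ Y X →
      ((tracelessHerm d₁).orthogonalProjectionOnto (Y 0).1,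
        (tracelessHerm d₂).orthogonalProjectionOnto (Y 0).2) = z → IsPoincareRecurrent X := by
    filter_upwards [ae_exists_recurrent_mirror μ₁ μ₂ S₁ S₂ hzs hE₁ hE₂] with z hz Y X hYX hYz
    obtain ⟨τ, hτ, hlim⟩ := hz Y (fun t ht => by
      have h := (hYX t ht).2.2
      rw [hX hYX t ht] at h
      exact h) hYz
    refine ⟨fun n => τ n, fun n => Nat.cast_nonneg _, fun a b hab => Nat.cast_lt.2 (hτ hab),
      tendsto_natCast_atTop_atTop.comp hτ.tendsto_atTop, ?_⟩
    rw [hX hYX 0 le_rfl]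
    exact hlim.congr fun n => (hX hYX _ (Nat.cast_nonneg _)).symm
  refine ⟨fun Y₀ => ?_, ?_, ?_⟩
  · obtain ⟨Y, hY, h0⟩ := exists_isForwardTrajectory_mirror S₁ S₂ G.gradientCLM₁ G.gradientCLM₂ Y₀
    exact ⟨Y, fun t => (Q₁ (Y t).1, Q₂ (Y t).2),
      fun t ht => ⟨S₁.mirror _, S₂.mirror _, hY t ht⟩, h0⟩
  · -- The projection to the traceless parts is a surjective linear map, so preimages of null sets
    -- under it are null.
    set P : Herm d₁ × Herm d₂ →ₗ[ℝ] tracelessHerm d₁ × tracelessHerm d₂ :=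
      (tracelessHerm d₁).orthogonalProjectionOnto.toLinearMap.prodMap
        (tracelessHerm d₂).orthogonalProjectionOnto.toLinearMap
    have hP : Function.Surjective P := fun z => ⟨(z.1, z.2), by simp [P]⟩
    have : (hermLebesgue d₁ d₂).IsAddHaarMeasure := by unfold hermLebesgue; infer_instance
    filter_upwards [ae_comp_linearMap_of_surjective (hermLebesgue d₁ d₂) (μ₁.prod μ₂) hP hrec]
      with Y₀ hY₀ Y X hYX h0
    subst h0
    exact hY₀ Y X hYX rfl
  · rw [ae_stateLebesgue_iff]
    -- In the chart, the initial state is a Lipschitz function of the projected initial score, so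
    -- exceptional initial states form the Lipschitz image of a null set.
    obtain ⟨q₁, hq₁, K₁, hK₁⟩ := S₁.exists_lipschitzWith_chart
    obtain ⟨q₂, hq₂, K₂, hK₂⟩ := S₂.exists_lipschitzWith_chart
    have hlip := (hK₁.comp (LipschitzWith.prod_fst (β := tracelessHerm d₂))).prodMk
      (hK₂.comp (LipschitzWith.prod_snd (α := tracelessHerm d₁)))
    filter_upwards [ae_forall_eq_of_lipschitzWith (μ₁.prod μ₂) hlip hrec] with w hw Y X hYX h0
    refine hw ((tracelessHerm d₁).orthogonalProjectionOnto (Y 0).1,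
      (tracelessHerm d₂).orthogonalProjectionOnto (Y 0).2) ?_ Y X hYX rfl
    rw [hX hYX 0 le_rfl] at h0
    have h₁ : Q₁ (Y 0).1 = maximallyMixed d₁ + (w.1 : Herm d₁) := congrArg Prod.fst h0
    have h₂ : Q₂ (Y 0).2 = maximallyMixed d₂ + (w.2 : Herm d₂) := congrArg Prod.snd h0
    refine Prod.ext (Subtype.ext ?_) (Subtype.ext ?_)
    · change (q₁ _ : Herm d₁) = w.1
      rw [hq₁, h₁, add_sub_cancel_left]
    · change (q₂ _ : Herm d₂) = w.2
      rw [hq₂, h₂, add_sub_cancel_left]
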